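/- Let $\mathbb K$ be a field of characteristic $0$. Consider the Hopf monoid $\mathbf{SG}$ in linear species in which $\mathbf{SG}[V]$ is the vector space spanned by the simple graphs on the finite set $V$, with product $g_1\otimes g_2\mapsto g_1\sqcup g_2$ and coproduct $\Delta_{V_1,V_2}(g)=g|_{V_1}\otimes g/_{V_1}$. Here $g|_{V_1}$ is the subgraph induced on $V_1$, and $g/_{V_1}$ is the simple graph on $V_2$ in which two distinct vertices are adjacent iff $g$ has a path between them all of whose inner vertices lie in $V_1$ ($g$ is *sewn through* $V_1$). A character $\zeta$ of $\mathbf{SG}$ is a family of linear forms $\zeta_V:\mathbf{SG}[V]\to\mathbb K$ that is natural in bijections, multiplicative, and takes the value $1$ on the empty graph. For a graph $g$ on $V$ and an integer $n\ge 0$ put $$\chi^\zeta_V(g)(n)=\sum_{V=V_1\sqcup\dots\sqcup V_n}\zeta_V\circ\mu_{V_1,\dots,V_n}\circ\Delta_{V_1,\dots,V_n}(g),$$ the sum being over all ordered decompositions of $V$ into $n$ possibly empty parts. *Forests.* A partitioning tree of a connected graph $g$ on $V$ is a rooted tree whose nodes are the parts of a partition of $V$, defined inductively: choose a root $\emptyset\neq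 W\subseteq V$ and a partitioning tree of each connected component of $g|_{V\setminus W}$; these trees are the direct subtrees of $W$. A partitioning forest of a graph $g$ is a disjoint union of partitioning trees, one for each connected component of $g$; $\mathrm{PF}(g)$ is the set of these. For $F\in\mathrm{PF}(g)$, the graph $g_F$ on $V$ is obtained as follows: for every leaf $p$ of $F$ add to $g_F$ the graph induced on $p$, sew the graph through all the leaves, delete the leaves from $F$, and repeat with the new graph and the new forest until the forest is empty. A coloring $c:V\to[n]$ is (strictly) compatible with $F$ if it is constant on every node and (strictly) increasing from descendants to ancestors; $C_{F,n}$ and $C^{<}_{F,n}$ denote the sets of compatible and of strictly compatible colorings with $[n]$. Write $\mathrm{cc}(h)$ for the number of connected components of $h$. Call $F\in\mathrm{PF}(g)$ a $\zeta$-partitioning forest if $\zeta(g_F)\ne0$. **Proposition.** Let $\zeta$ be a character of $\mathbf{SG}$, $V$ a finite set and $g$ a simple graph on $V$. Then $\chi^\zeta_V(g)$ is a polynomial function of $n$; denote by $\chi^\zeta_V(g)(-n)$ the value of this polynomial at $-n$. For all integers $n\ge 0$, $$\chi^\zeta_V(g)(n)=\sum_{F\in \mathrm{PF}(g)}\zeta(g_F)\,|C^{<}_{F,n}|,\qquad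 \chi^\zeta_V(g)(-n)=\sum_{F\in \mathrm{PF}(g)}(-1)^{\mathrm{cc}(g_F)}\zeta(g_F)\,|C_{F,n}|.$$ If $\zeta$ takes only the values $0$ and $1$ on graphs, then $\chi^\zeta_V(g)(n)$ is the number of pairs $(F,c)$ formed of a $\zeta$-partitioning forest $F$ of $g$ and a coloring $c$ with $[n]$ strictly compatible with $F$. If moreover $\zeta$ is odd (the connected graphs on which $\zeta$ is not zero have an odd number of vertices), then $(-1)^{|V|}\chi^\zeta_V(g)(-n)$ is the number of such pairs that are compatible; in particular $(-1)^{|V|}\chi^\zeta_V(g)(-1)$ is the number of $\zeta$-partitioning forests of $g$. Finally, $\mathrm{PF}(g)$ is equal to the set of $B$-forests for the building set $B=\mathrm{tubes}(g)$ of all subsets of $V$ that induce a connected subgraph of $g$. Here a $B$-forest is a rooted forest $F$ whose nodes are the parts of a partition of $V$ such that, writing $F_{\le p}$ for the union of $p$ and its descendants: (1) $F_{\le r}$ is a connected component (a maximal element) of $B$ for every root $r$; (2) $F_{\le p}\in B$ for every node $p$; (3) $\bigcup_i F_{\le p_i}\notin B$ for any $k\ge2$ pairwise incomparable nodes $p_1,\dots,p_k$.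 -/

import Mathlib

open scoped TensorProduct

universe u w x

noncomputable section

namespace RipSew

/-! ### Linear species, connected Hopf monoids, characters and the polynomial invariant -/

/-- A linear species: a functor from finite sets and bijections to finite-dimensional
vector spaces over `K`. -/
structure LinearSpecies (K : Type w) [Field K] where
  obj : (V : Type u) → [Finite V] → Type x
  [addCommGroup : ∀ (V : Type u) [Finite V], AddCommGroup (obj V)]
  [module : ∀ (V : Type u) [Finite V], Module K (obj V)]
  finite : ∀ (V : Type u) [Finite V], Module.Finite K (obj V)
  map : ∀ {V W : Type u} [Finite V] [Finite W], (V ≃ W) → (obj V →ₗ[K] obj W)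
  map_refl : ∀ (V : Type u) [Finite V], map (Equiv.refl V) = LinearMap.id
  map_trans : ∀ {V W X : Type u} [Finite V] [Finite W] [Finite X] (σ : V ≃ W) (τ : W ≃ X),
    map (σ.trans τ) = map τ ∘ₗ map σ

attribute [instance] LinearSpecies.addCommGroup LinearSpecies.module

/-- A connected Hopf monoid in linear species. A decomposition `V = V₁ ⊔ V₂` is presented by
the disjoint union `V₁ ⊕ V₂`; naturality transports the structure maps along the bijection of
`V₁ ⊕ V₂` with any set decomposed into copies of `V₁` and `V₂`. -/
structure HopfMonoid (K : Type w) [Field K] extends LinearSpecies.{u, w, x} K where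
  mul : ∀ (V₁ V₂ : Type u) [Finite V₁] [Finite V₂], obj V₁ ⊗[K] obj V₂ →ₗ[K] obj (V₁ ⊕ V₂)
  comul : ∀ (V₁ V₂ : Type u) [Finite V₁] [Finite V₂], obj (V₁ ⊕ V₂) →ₗ[K] obj V₁ ⊗[K] obj V₂
  /-- The identification of the space over the empty set with the ground field. -/
  unit : K ≃ₗ[K] obj PEmpty
  mul_natural : ∀ {V₁ V₂ W₁ W₂ : Type u} [Finite V₁] [Finite V₂] [Finite W₁] [Finite W₂]
    (σ : V₁ ≃ W₁) (τ : V₂ ≃ W₂),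
    mul W₁ W₂ ∘ₗ TensorProduct.map (map σ) (map τ) = map (σ.sumCongr τ) ∘ₗ mul V₁ V₂
  comul_natural : ∀ {V₁ V₂ W₁ W₂ : Type u} [Finite V₁] [Finite V₂] [Finite W₁] [Finite W₂]
    (σ : V₁ ≃ W₁) (τ : V₂ ≃ W₂),
    comul W₁ W₂ ∘ₗ map (σ.sumCongr τ) = TensorProduct.map (map σ) (map τ) ∘ₗ comul V₁ V₂
  mul_unit : ∀ (V : Type u) [Finite V] (a : obj V),
    map (Equiv.sumEmpty V PEmpty) (mul V PEmpty (a ⊗ₜ[K] unit 1)) = a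
  unit_mul : ∀ (V : Type u) [Finite V] (a : obj V),
    map (Equiv.emptySum PEmpty V) (mul PEmpty V (unit 1 ⊗ₜ[K] a)) = a
  comul_unit : ∀ (V : Type u) [Finite V] (a : obj V),
    comul V PEmpty (map (Equiv.sumEmpty V PEmpty).symm a) = a ⊗ₜ[K] unit 1
  unit_comul : ∀ (V : Type u) [Finite V] (a : obj V),
    comul PEmpty V (map (Equiv.emptySum PEmpty V).symm a) = unit 1 ⊗ₜ[K] a
  mul_assoc : ∀ (V₁ V₂ V₃ : Type u) [Finite V₁] [Finite V₂] [Finite V₃],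
    map (Equiv.sumAssoc V₁ V₂ V₃) ∘ₗ mul (V₁ ⊕ V₂) V₃ ∘ₗ
        TensorProduct.map (mul V₁ V₂) LinearMap.id =
      mul V₁ (V₂ ⊕ V₃) ∘ₗ TensorProduct.map LinearMap.id (mul V₂ V₃) ∘ₗ
        (TensorProduct.assoc K (obj V₁) (obj V₂) (obj V₃)).toLinearMap
  comul_coassoc : ∀ (V₁ V₂ V₃ : Type u) [Finite V₁] [Finite V₂] [Finite V₃],
    (TensorProduct.assoc K (obj V₁) (obj V₂) (obj V₃)).toLinearMap ∘ₗ
        TensorProduct.map (comul V₁ V₂) LinearMap.id ∘ₗ comul (V₁ ⊕ V₂) V₃ =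
      TensorProduct.map LinearMap.id (comul V₂ V₃) ∘ₗ comul V₁ (V₂ ⊕ V₃) ∘ₗ
        map (Equiv.sumAssoc V₁ V₂ V₃)
  compat : ∀ (A B C D : Type u) [Finite A] [Finite B] [Finite C] [Finite D],
    comul (A ⊕ C) (B ⊕ D) ∘ₗ map (Equiv.sumSumSumComm A B C D) ∘ₗ mul (A ⊕ B) (C ⊕ D) =
      TensorProduct.map (mul A C) (mul B D) ∘ₗ
        (TensorProduct.tensorTensorTensorComm K (obj A) (obj B) (obj C) (obj D)).toLinearMap ∘ₗ
        TensorProduct.map (comul A B) (comul C D)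

/-- A character of a Hopf monoid: a natural, multiplicative and unital family of linear forms. -/
structure Character {K : Type w} [Field K] (M : HopfMonoid.{u, w, x} K) where
  toFun : ∀ (V : Type u) [Finite V], M.obj V →ₗ[K] K
  natural : ∀ {V W : Type u} [Finite V] [Finite W] (σ : V ≃ W) (a : M.obj V),
    toFun W (M.map σ a) = toFun V a
  map_mul : ∀ (V₁ V₂ : Type u) [Finite V₁] [Finite V₂] (a : M.obj V₁) (b : M.obj V₂),
    toFun (V₁ ⊕ V₂) (M.mul V₁ V₂ (a ⊗ₜ[K] b)) = toFun V₁ a * toFun V₂ b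
  map_unit : toFun PEmpty (M.unit 1) = 1

/-- The composite `μ_{V₁,…,Vₙ} ∘ Δ_{V₁,…,Vₙ} : M[V] → M[V]` for the decomposition of `V` into
the colour classes `Vᵢ` of `c : V → Fin n` (so the first part is the class of the smallest
colour). The iterated maps are unfolded as
`μ_{V₁,V₂⊔…⊔Vₙ} ∘ (id ⊗ (μ_{V₂,…,Vₙ} ∘ Δ_{V₂,…,Vₙ})) ∘ Δ_{V₁,V₂⊔…⊔Vₙ}`. -/
def mulComul {K : Type w} [Field K] (M : HopfMonoid.{u, w, x} K) :
    (n : ℕ) → (V : Type u) → [Finite V] → (V → Fin n) → (M.obj V →ₗ[K] M.obj V)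
  | 0, _, _, _ => LinearMap.id
  | n + 1, V, _, c =>
    M.map (Equiv.sumCompl fun v : V => c v = 0) ∘ₗ
      M.mul {v : V // c v = 0} {v : V // ¬ c v = 0} ∘ₗ
      TensorProduct.map LinearMap.id
        (mulComul M n {v : V // ¬ c v = 0} fun v => (c v.1).pred v.2) ∘ₗ
      M.comul {v : V // c v = 0} {v : V // ¬ c v = 0} ∘ₗ
      M.map (Equiv.sumCompl fun v : V => c v = 0).symm

/-- `χ^ζ_V(a)(n)`: the sum of `ζ_V ∘ μ_{V₁,…,Vₙ} ∘ Δ_{V₁,…,Vₙ} (a)` over all decompositions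
`V = V₁ ⊔ … ⊔ Vₙ` into `n` possibly empty parts, that is over all maps `V → Fin n`. -/
def chi {K : Type w} [Field K] {M : HopfMonoid.{u, w, x} K} (ζ : Character M)
    {V : Type u} [Finite V] (a : M.obj V) (n : ℕ) : K :=
  ∑ᶠ c : V → Fin n, ζ.toFun V (mulComul M n V c a)

/-! ### Ripping and sewing graphs -/

/-- The graph `g` sewn through `S`: two distinct vertices outside `S` are adjacent when `g` has
a path between them all of whose vertices other than the ends are in `S`. The vertices of `S`
are kept as isolated vertices; the graph `g/_S` is the restriction of this graph to `Sᶜ`. -/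
def sew {V : Type*} (g : SimpleGraph V) (S : Set V) : SimpleGraph V where
  Adj v w := v ≠ w ∧ v ∉ S ∧ w ∉ S ∧
    ∃ p : g.Walk v w, p.IsPath ∧ ∀ a ∈ p.support, a ≠ v → a ≠ w → a ∈ S
  symm := ⟨by
    rintro v w ⟨h, hv, hw, p, hp, hS⟩
    exact ⟨h.symm, hw, hv, p.reverse, hp.reverse, fun a ha h1 h2 => hS a (by simpa using ha) h2 h1⟩⟩
  loopless := ⟨fun v h => h.1 rfl⟩

/-- Auxiliary form of the path condition in `sew`, used to verify the Hopf monoid axioms. -/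
inductive Thru {V : Type*} (g : SimpleGraph V) (S : Set V) : V → V → Prop
  | adj {v w : V} : g.Adj v w → Thru g S v w
  | step {v a w : V} : g.Adj v a → a ∈ S → Thru g S a w → Thru g S v w

theorem Thru.exists_walk {V : Type*} {g : SimpleGraph V} {S : Set V} {v w : V}
    (h : Thru g S v w) : ∃ p : g.Walk v w, ∀ a ∈ p.support, a ≠ v → a ≠ w → a ∈ S := by
  induction h with
  | adj h =>
    refine ⟨.cons h .nil, ?_⟩
    intro a ha h1 h2
    simp at ha
    tauto
  | @step v b w h hb _ ih =>
    obtain ⟨p, hp⟩ := ih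
    refine ⟨.cons h p, ?_⟩
    intro a ha h1 h2
    simp only [SimpleGraph.Walk.support_cons, List.mem_cons] at ha
    by_cases hab : a = b
    · exact hab ▸ hb
    · exact hp a (ha.resolve_left h1) hab h2

theorem thru_of_path {V : Type*} {g : SimpleGraph V} {S : Set V} {v w : V} (p : g.Walk v w) :
    v ≠ w → p.IsPath → (∀ a ∈ p.support, a ≠ v → a ≠ w → a ∈ S) → Thru g S v w := by
  induction p with
  | nil => intro h; exact absurd rfl h
  | @cons v b w h p ih =>
    intro hvw hp hS
    rw [SimpleGraph.Walk.cons_isPath_iff] at hp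
    by_cases hbw : b = w
    · subst hbw; exact .adj h
    · refine .step h (hS b (by simp) h.ne' hbw) (ih hbw hp.1 ?_)
      intro a ha h1 h2
      refine hS a (by simp [ha]) ?_ h2
      rintro rfl
      exact hp.2 ha

theorem sew_adj {V : Type*} {g : SimpleGraph V} {S : Set V} {v w : V} :
    (sew g S).Adj v w ↔ v ≠ w ∧ v ∉ S ∧ w ∉ S ∧ Thru g S v w := by
  classical
  constructor
  · rintro ⟨h, hv, hw, p, hp, hS⟩
    exact ⟨h, hv, hw, thru_of_path p h hp hS⟩
  · rintro ⟨h, hv, hw, ht⟩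
    obtain ⟨p, hp⟩ := ht.exists_walk
    exact ⟨h, hv, hw, p.bypass, p.bypass_isPath, fun a ha => hp a (p.support_bypass_subset_support ha)⟩

theorem Thru.image {V W : Type*} {g : SimpleGraph V} {h : SimpleGraph W} {S : Set V} {S' : Set W}
    (f : V → W) (hf : ∀ a b, g.Adj a b → h.Adj (f a) (f b)) (hS : ∀ a ∈ S, f a ∈ S') {v w : V}
    (t : Thru g S v w) : Thru h S' (f v) (f w) := by
  induction t with
  | adj e => exact .adj (hf _ _ e)
  | step e ha _ ih => exact .step (hf _ _ e) (hS _ ha) ih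

theorem thru_comap {V W : Type*} {g : SimpleGraph V} {S : Set V} (f : W → V)
    (hS : S ⊆ Set.range f) {v : W} {b : V} (t : Thru g S (f v) b) :
    ∀ w, b = f w → Thru (g.comap f) (f ⁻¹' S) v w := by
  generalize hx : f v = x at t
  induction t generalizing v with
  | adj e => rintro w rfl; subst hx; exact .adj e
  | step e ha _ ih =>
    rintro w rfl
    subst hx
    obtain ⟨a', rfl⟩ := hS ha
    exact .step (a := a') e ha (ih rfl w rfl)

theorem sew_comap {V W : Type*} (g : SimpleGraph V) (S : Set V) (f : W → V)
    (hf : Function.Injective f) (hS : S ⊆ Set.range f) :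
    (sew g S).comap f = sew (g.comap f) (f ⁻¹' S) := by
  ext v w
  simp only [SimpleGraph.comap_adj, sew_adj, hf.ne_iff, Set.mem_preimage]
  refine and_congr_right fun _ => and_congr_right fun _ => and_congr_right fun _ => ?_
  exact ⟨fun t => thru_comap f hS t w rfl, fun t => t.image f (fun _ _ e => e) (fun _ h => h)⟩

theorem Thru.trans {V : Type*} {g : SimpleGraph V} {S : Set V} {a b c : V}
    (h1 : Thru g S a b) (hb : b ∈ S) (h2 : Thru g S b c) : Thru g S a c := by
  induction h1 with
  | adj e => exact .step e hb h2
  | step e ha _ ih => exact .step e ha (ih hb h2)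

theorem Thru.mono {V : Type*} {g : SimpleGraph V} {S T : Set V} (h : S ⊆ T) {a b : V}
    (t : Thru g S a b) : Thru g T a b := t.image id (fun _ _ e => e) (fun _ ha => h ha)

theorem thru_sew {V : Type*} {g : SimpleGraph V} {A B : Set V} {a w : V} (hw : w ∉ A)
    (t : Thru g (A ∪ B) a w) :
    (a ∉ A → a = w ∨ Thru (sew g A) B a w) ∧
    (a ∈ A → ∃ y, y ∉ A ∧ Thru g A a y ∧ (y = w ∨ (y ∈ B ∧ Thru (sew g A) B y w))) := by
  induction t with
  | adj e =>
    exact ⟨fun h => .inr (.adj (sew_adj.2 ⟨e.ne, h, hw, .adj e⟩)),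
      fun _ => ⟨_, hw, .adj e, .inl rfl⟩⟩
  | @step v b w e hb _ ih =>
    obtain ⟨ih1, ih2⟩ := ih hw
    constructor
    · intro hv
      by_cases hbA : b ∈ A
      · obtain ⟨y, hy, t, h⟩ := ih2 hbA
        by_cases hvy : v = y
        · subst hvy
          exact h.imp id And.right
        · have e' : (sew g A).Adj v y := sew_adj.2 ⟨hvy, hv, hy, .step e hbA t⟩
          rcases h with rfl | ⟨hyB, h⟩
          · exact .inr (.adj e')
          · exact .inr (.step e' hyB h)
      · have e' : (sew g A).Adj v b := sew_adj.2 ⟨e.ne, hv, hbA, .adj e⟩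
        rcases ih1 hbA with rfl | h
        · exact .inr (.adj e')
        · exact .inr (.step e' (hb.resolve_left hbA) h)
    · intro hv
      by_cases hbA : b ∈ A
      · obtain ⟨y, hy, t, h⟩ := ih2 hbA
        exact ⟨y, hy, .step e hbA t, h⟩
      · exact ⟨b, hbA, .adj e, (ih1 hbA).imp id fun h => ⟨hb.resolve_left hbA, h⟩⟩

theorem sew_sew {V : Type*} (g : SimpleGraph V) (A B : Set V) :
    sew (sew g A) B = sew g (A ∪ B) := by
  have back : ∀ {v w : V}, Thru (sew g A) B v w → v ∉ A ∧ w ∉ A ∧ Thru g (A ∪ B) v w := by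
    intro v w t
    induction t with
    | adj e =>
      obtain ⟨_, h1, h2, h3⟩ := sew_adj.1 e
      exact ⟨h1, h2, h3.mono Set.subset_union_left⟩
    | step e ha _ ih =>
      obtain ⟨_, h1, h2, h3⟩ := sew_adj.1 e
      exact ⟨h1, ih.2.1, (h3.mono Set.subset_union_left).trans (.inr ha) ih.2.2⟩
  ext v w
  rw [sew_adj, sew_adj]
  constructor
  · rintro ⟨h, hv, hw, t⟩
    obtain ⟨h1, h2, h3⟩ := back t
    exact ⟨h, by simp [h1, hv], by simp [h2, hw], h3⟩
  · rintro ⟨h, hv, hw, t⟩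
    simp only [Set.mem_union, not_or] at hv hw
    exact ⟨h, hv.2, hw.2, ((thru_sew hw.1 t).1 hv.1).resolve_left h⟩

/-! ### The Hopf monoid of simple graphs with ripping and sewing -/

/-- The first tensor factor of the coproduct: the subgraph induced by the first part. -/
def ripPart {V₁ V₂ : Type*} (g : SimpleGraph (V₁ ⊕ V₂)) : SimpleGraph V₁ := g.comap Sum.inl

/-- The second tensor factor of the coproduct: the graph on the second part obtained by sewing
through the first part. -/
def sewPart {V₁ V₂ : Type*} (g : SimpleGraph (V₁ ⊕ V₂)) : SimpleGraph V₂ :=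
  (sew g (Set.range Sum.inl)).comap Sum.inr

theorem ripPart_nat {V₁ V₂ W₁ W₂ : Type*} (σ : V₁ ≃ W₁) (τ : V₂ ≃ W₂)
    (g : SimpleGraph (V₁ ⊕ V₂)) :
    ripPart (g.comap (σ.sumCongr τ).symm) = (ripPart g).comap σ.symm := by
  ext; simp [ripPart]

theorem sewPart_nat {V₁ V₂ W₁ W₂ : Type*} (σ : V₁ ≃ W₁) (τ : V₂ ≃ W₂)
    (g : SimpleGraph (V₁ ⊕ V₂)) :
    sewPart (g.comap (σ.sumCongr τ).symm) = (sewPart g).comap τ.symm := by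
  have h : (σ.sumCongr τ).symm ⁻¹' (Set.range Sum.inl : Set (V₁ ⊕ V₂)) = Set.range Sum.inl := by
    ext (a | a) <;> simp
  have := sew_comap g (Set.range Sum.inl) (σ.sumCongr τ).symm (Equiv.injective _) (by
    rw [(σ.sumCongr τ).symm.surjective.range_eq]; exact Set.subset_univ _)
  rw [h] at this
  rw [sewPart, ← this]
  ext; simp [sewPart]

theorem not_thru_sum {V W : Type*} {g : SimpleGraph V} {h : SimpleGraph W} {S : Set (V ⊕ W)}
    {a b : V ⊕ W} (t : Thru (g ⊕g h) S a b) :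
    (∃ v v', a = Sum.inl v ∧ b = Sum.inl v' ∧ Thru g (Sum.inl ⁻¹' S) v v') ∨
    (∃ v v', a = Sum.inr v ∧ b = Sum.inr v' ∧ Thru h (Sum.inr ⁻¹' S) v v') := by
  induction t with
  | @adj v w e =>
    rcases v with v | v <;> rcases w with w | w <;> simp at e
    · exact .inl ⟨v, w, rfl, rfl, .adj e⟩
    · exact .inr ⟨v, w, rfl, rfl, .adj e⟩
  | @step v a w e ha _ ih =>
    rcases ih with ⟨x, y, rfl, rfl, t⟩ | ⟨x, y, rfl, rfl, t⟩ <;> rcases v with v | v <;> simp at e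
    · exact .inl ⟨v, y, rfl, rfl, .step e ha t⟩
    · exact .inr ⟨v, y, rfl, rfl, .step e ha t⟩

theorem sew_sum {V W : Type*} (g : SimpleGraph V) (h : SimpleGraph W) (S : Set (V ⊕ W)) :
    sew (g ⊕g h) S = sew g (Sum.inl ⁻¹' S) ⊕g sew h (Sum.inr ⁻¹' S) := by
  ext a b
  rcases a with a | a <;> rcases b with b | b
  · simp only [sew_adj, SimpleGraph.sum_adj, Set.mem_preimage, ne_eq, Sum.inl.injEq]
    refine and_congr_right fun _ => and_congr_right fun _ => and_congr_right fun _ =>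
      ⟨fun t => ?_, fun t => t.image Sum.inl (fun _ _ e => by simpa using e) (fun _ h => h)⟩
    rcases not_thru_sum t with ⟨_, _, h1, h2, t⟩ | ⟨_, _, h1, h2, t⟩ <;> simp_all
  · simp only [sew_adj, SimpleGraph.sum_adj, iff_false]
    rintro ⟨-, -, -, t⟩
    rcases not_thru_sum t with ⟨_, _, h1, h2, t⟩ | ⟨_, _, h1, h2, t⟩ <;> simp_all
  · simp only [sew_adj, SimpleGraph.sum_adj, iff_false]
    rintro ⟨-, -, -, t⟩
    rcases not_thru_sum t with ⟨_, _, h1, h2, t⟩ | ⟨_, _, h1, h2, t⟩ <;> simp_all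
  · simp only [sew_adj, SimpleGraph.sum_adj, Set.mem_preimage, ne_eq, Sum.inr.injEq]
    refine and_congr_right fun _ => and_congr_right fun _ => and_congr_right fun _ =>
      ⟨fun t => ?_, fun t => t.image Sum.inr (fun _ _ e => by simpa using e) (fun _ h => h)⟩
    rcases not_thru_sum t with ⟨_, _, h1, h2, t⟩ | ⟨_, _, h1, h2, t⟩ <;> simp_all

section SG

variable (K : Type w) [Field K]

/-- Relabelling of graphs along a bijection, extended linearly. -/
def sgMap {V W : Type u} (σ : V ≃ W) : (SimpleGraph V →₀ K) →ₗ[K] (SimpleGraph W →₀ K) :=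
  Finsupp.lmapDomain K K fun g => g.comap σ.symm

/-- The product of graphs: disjoint union, extended bilinearly. -/
def sgMul (V₁ V₂ : Type u) :
    (SimpleGraph V₁ →₀ K) ⊗[K] (SimpleGraph V₂ →₀ K) →ₗ[K] (SimpleGraph (V₁ ⊕ V₂) →₀ K) :=
  TensorProduct.lift (Finsupp.lsum K fun g₁ => LinearMap.toSpanSingleton K _
    (Finsupp.lmapDomain K K fun g₂ => g₁ ⊕g g₂))

/-- The coproduct of graphs: ripping out the first part and sewing through it, extended
linearly. -/
def sgComul (V₁ V₂ : Type u) :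
    (SimpleGraph (V₁ ⊕ V₂) →₀ K) →ₗ[K] (SimpleGraph V₁ →₀ K) ⊗[K] (SimpleGraph V₂ →₀ K) :=
  Finsupp.linearCombination K fun g =>
    Finsupp.single (ripPart g) (1 : K) ⊗ₜ[K] Finsupp.single (sewPart g) (1 : K)

theorem sgMap_single {V W : Type u} (σ : V ≃ W) (g : SimpleGraph V) (r : K) :
    sgMap K σ (Finsupp.single g r) = Finsupp.single (g.comap σ.symm) r := by
  simp [sgMap]

theorem sgMul_single {V W : Type u} (g : SimpleGraph V) (h : SimpleGraph W) (r s : K) :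
    sgMul K V W (Finsupp.single g r ⊗ₜ[K] Finsupp.single h s) =
      Finsupp.single (g ⊕g h) (r * s) := by
  simp [sgMul]

theorem sgComul_single {V W : Type u} (g : SimpleGraph (V ⊕ W)) :
    sgComul K V W (Finsupp.single g 1) =
      Finsupp.single (ripPart g) (1 : K) ⊗ₜ[K] Finsupp.single (sewPart g) (1 : K) := by
  simp [sgComul]

theorem sg_ext {V : Type u} {N : Type*} [AddCommMonoid N] [Module K N]
    {f f' : (SimpleGraph V →₀ K) →ₗ[K] N}
    (h : ∀ g, f (Finsupp.single g 1) = f' (Finsupp.single g 1)) : f = f' := by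
  ext g; exact h g

theorem sg_ext₂ {V W : Type u} {N : Type*} [AddCommMonoid N] [Module K N]
    {f f' : (SimpleGraph V →₀ K) ⊗[K] (SimpleGraph W →₀ K) →ₗ[K] N}
    (h : ∀ g g', f (Finsupp.single g 1 ⊗ₜ[K] Finsupp.single g' 1) =
      f' (Finsupp.single g 1 ⊗ₜ[K] Finsupp.single g' 1)) : f = f' := by
  apply TensorProduct.ext
  apply sg_ext; intro g
  apply sg_ext; intro g'
  exact h g g'

theorem sg_ext₃ {V W X : Type u} {N : Type*} [AddCommMonoid N] [Module K N]
    {f f' : ((SimpleGraph V →₀ K) ⊗[K] (SimpleGraph W →₀ K)) ⊗[K] (SimpleGraph X →₀ K) →ₗ[K] N}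
    (h : ∀ g g' g'', f ((Finsupp.single g 1 ⊗ₜ[K] Finsupp.single g' 1) ⊗ₜ Finsupp.single g'' 1) =
      f' ((Finsupp.single g 1 ⊗ₜ[K] Finsupp.single g' 1) ⊗ₜ Finsupp.single g'' 1)) : f = f' := by
  apply TensorProduct.ext
  apply sg_ext₂; intro g g'
  apply sg_ext; intro g''
  exact h g g' g''

theorem sew_empty {V : Type*} (g : SimpleGraph V) {S : Set V} (h : S = ∅) : sew g S = g := by
  subst h
  ext v w
  simp only [sew_adj, Set.mem_empty_iff_false, not_false_eq_true, true_and]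
  constructor
  · rintro ⟨_, t⟩
    cases t with
    | adj e => exact e
    | step _ h _ => exact h.elim
  · intro e
    exact ⟨e.ne, .adj e⟩

/-- The basis vector of the one-dimensional space over the empty set. -/
def sgUnit : K ≃ₗ[K] (SimpleGraph PEmpty.{u + 1} →₀ K) :=
  (Finsupp.uniqueLinearEquiv K K (⊥ : SimpleGraph PEmpty.{u + 1})).symm

theorem sgUnit_one : sgUnit.{u} K 1 = Finsupp.single ⊥ 1 := by
  simp [sgUnit]

theorem ripPart_assoc {V₁ V₂ V₃ : Type*} (g : SimpleGraph ((V₁ ⊕ V₂) ⊕ V₃)) :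
    ripPart (g.comap (Equiv.sumAssoc V₁ V₂ V₃).symm) = ripPart (ripPart g) := by
  ext; simp [ripPart]

theorem sewPart_assoc₁ {V₁ V₂ V₃ : Type*} (g : SimpleGraph ((V₁ ⊕ V₂) ⊕ V₃)) :
    ripPart (sewPart (g.comap (Equiv.sumAssoc V₁ V₂ V₃).symm)) = sewPart (ripPart g) := by
  have h1 := sew_comap g (Set.range (Sum.inl ∘ Sum.inl)) (Equiv.sumAssoc V₁ V₂ V₃).symm
    (Equiv.injective _) (by rw [(Equiv.surjective _).range_eq]; exact Set.subset_univ _)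
  have h2 := sew_comap g (Set.range (Sum.inl ∘ Sum.inl)) (Sum.inl : V₁ ⊕ V₂ → _)
    Sum.inl_injective (by rintro _ ⟨a, rfl⟩; exact ⟨_, rfl⟩)
  have e1 : (Equiv.sumAssoc V₁ V₂ V₃).symm ⁻¹' Set.range (Sum.inl ∘ Sum.inl) =
      Set.range Sum.inl := by ext (a | a | a) <;> simp
  have e2 : (Sum.inl : V₁ ⊕ V₂ → (V₁ ⊕ V₂) ⊕ V₃) ⁻¹' Set.range (Sum.inl ∘ Sum.inl) =
      Set.range Sum.inl := by ext (a | a) <;> simp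
  rw [e1] at h1
  rw [e2] at h2
  rw [ripPart, ripPart, sewPart, sewPart, ← h1, ← h2]
  ext; simp

theorem sewPart_assoc₂ {V₁ V₂ V₃ : Type*} (g : SimpleGraph ((V₁ ⊕ V₂) ⊕ V₃)) :
    sewPart (sewPart (g.comap (Equiv.sumAssoc V₁ V₂ V₃).symm)) = sewPart g := by
  have h0 := sew_sew (g.comap (Equiv.sumAssoc V₁ V₂ V₃).symm) (Set.range Sum.inl)
    (Set.range (Sum.inr ∘ Sum.inl))
  have h1 := sew_comap (sew (g.comap (Equiv.sumAssoc V₁ V₂ V₃).symm) (Set.range Sum.inl))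
    (Set.range (Sum.inr ∘ Sum.inl)) (Sum.inr : V₂ ⊕ V₃ → _)
    Sum.inr_injective (by rintro _ ⟨a, rfl⟩; exact ⟨_, rfl⟩)
  have h2 := sew_comap g (Set.range Sum.inl) (Equiv.sumAssoc V₁ V₂ V₃).symm
    (Equiv.injective _) (by rw [(Equiv.surjective _).range_eq]; exact Set.subset_univ _)
  have e1 : (Sum.inr : V₂ ⊕ V₃ → V₁ ⊕ (V₂ ⊕ V₃)) ⁻¹' Set.range (Sum.inr ∘ Sum.inl) =
      Set.range Sum.inl := by ext (a | a) <;> simp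
  have e2 : (Equiv.sumAssoc V₁ V₂ V₃).symm ⁻¹' (Set.range Sum.inl) =
      Set.range Sum.inl ∪ Set.range (Sum.inr ∘ Sum.inl) := by ext (a | a | a) <;> simp
  rw [e1] at h1
  rw [e2] at h2
  rw [sewPart, sewPart, sewPart, ← h1, h0, ← h2]
  ext; simp

theorem ripPart_sum {A B C D : Type*} (g : SimpleGraph (A ⊕ B)) (h : SimpleGraph (C ⊕ D)) :
    ripPart ((g ⊕g h).comap (Equiv.sumSumSumComm A B C D).symm) = ripPart g ⊕g ripPart h := by
  ext (a | a) (b | b) <;> simp [ripPart]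

theorem sewPart_sum {A B C D : Type*} (g : SimpleGraph (A ⊕ B)) (h : SimpleGraph (C ⊕ D)) :
    sewPart ((g ⊕g h).comap (Equiv.sumSumSumComm A B C D).symm) = sewPart g ⊕g sewPart h := by
  have h1 := sew_comap (g ⊕g h) (Set.range (Sum.map Sum.inl Sum.inl))
    (Equiv.sumSumSumComm A B C D).symm
    (Equiv.injective _) (by rw [(Equiv.surjective _).range_eq]; exact Set.subset_univ _)
  have e1 : (Equiv.sumSumSumComm A B C D).symm ⁻¹' (Set.range (Sum.map Sum.inl Sum.inl)) =
      Set.range Sum.inl := by ext ((a | a) | (a | a)) <;> simp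
  have e2 : (Sum.inl : A ⊕ B → (A ⊕ B) ⊕ (C ⊕ D)) ⁻¹' (Set.range (Sum.map Sum.inl Sum.inl)) =
      Set.range Sum.inl := by ext (a | a) <;> simp
  have e3 : (Sum.inr : C ⊕ D → (A ⊕ B) ⊕ (C ⊕ D)) ⁻¹' (Set.range (Sum.map Sum.inl Sum.inl)) =
      Set.range Sum.inl := by ext (a | a) <;> simp
  rw [e1, sew_sum, e2, e3] at h1
  rw [sewPart, sewPart, sewPart, ← h1]
  ext (a | a) (b | b) <;> simp

/-- The Hopf monoid of simple graphs whose product is disjoint union and whose coproduct is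
`Δ_{V₁,V₂}(g) = g|_{V₁} ⊗ g/_{V₁}`. -/
def graphHopf : HopfMonoid.{u, w, max u w} K where
  obj V _ := SimpleGraph V →₀ K
  finite V _ := inferInstance
  map σ := sgMap K σ
  map_refl V _ := by
    apply sg_ext; intro g; rw [sgMap_single]; rfl
  map_trans σ τ := by
    apply sg_ext; intro g
    simp only [LinearMap.comp_apply, sgMap_single]; rfl
  mul V₁ V₂ _ _ := sgMul K V₁ V₂
  comul V₁ V₂ _ _ := sgComul K V₁ V₂
  unit := sgUnit K
  mul_natural σ τ := by
    apply sg_ext₂; intro g h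
    simp only [LinearMap.comp_apply, sgMap_single, sgMul_single, TensorProduct.map_tmul]
    congr 1
    ext (a | a) (b | b) <;> simp
  comul_natural σ τ := by
    apply sg_ext; intro g
    simp only [LinearMap.comp_apply, sgMap_single, sgComul_single, TensorProduct.map_tmul,
      ripPart_nat, sewPart_nat]
  mul_unit V _ a := by
    rw [sgUnit_one]
    induction a using Finsupp.induction_linear with
    | zero => simp
    | add a b ha hb => rw [TensorProduct.add_tmul, map_add, map_add, ha, hb]
    | single g r =>
      rw [sgMul_single, sgMap_single, mul_one]
      congr 1
  unit_mul V _ a := by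
    rw [sgUnit_one]
    induction a using Finsupp.induction_linear with
    | zero => simp
    | add a b ha hb => rw [TensorProduct.tmul_add, map_add, map_add, ha, hb]
    | single g r =>
      rw [sgMul_single, sgMap_single, one_mul]
      congr 1
  comul_unit V _ a := by
    rw [sgUnit_one]
    have h : sgComul K V PEmpty ∘ₗ sgMap K (Equiv.sumEmpty V PEmpty).symm =
        (TensorProduct.mk K _ _).flip (Finsupp.single ⊥ 1) := by
      apply sg_ext; intro g
      simp only [LinearMap.comp_apply, sgMap_single, sgComul_single, LinearMap.flip_apply,
        TensorProduct.mk_apply]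
      congr 2
      exact Subsingleton.elim _ _
    exact LinearMap.congr_fun h a
  unit_comul V _ a := by
    rw [sgUnit_one]
    have h : sgComul K PEmpty V ∘ₗ sgMap K (Equiv.emptySum PEmpty V).symm =
        TensorProduct.mk K _ _ (Finsupp.single ⊥ 1) := by
      apply sg_ext; intro g
      simp only [LinearMap.comp_apply, sgMap_single, sgComul_single,
        TensorProduct.mk_apply]
      congr 2
      · exact Subsingleton.elim _ _
      · rw [sewPart, sew_empty _ (Set.range_eq_empty (Sum.inl : PEmpty → _))]
        rfl
    exact LinearMap.congr_fun h a
  mul_assoc V₁ V₂ V₃ _ _ _ := by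
    apply sg_ext₃; intro g h k
    simp only [LinearMap.comp_apply, LinearEquiv.coe_coe, TensorProduct.assoc_tmul,
      sgMap_single, sgMul_single, TensorProduct.map_tmul, LinearMap.id_apply, mul_one]
    congr 1
    ext (a | a | a) (b | b | b) <;> simp
  comul_coassoc V₁ V₂ V₃ _ _ _ := by
    apply sg_ext; intro g
    simp only [LinearMap.comp_apply, LinearEquiv.coe_coe, TensorProduct.assoc_tmul,
      sgMap_single, sgComul_single, TensorProduct.map_tmul, LinearMap.id_apply,
      ripPart_assoc, sewPart_assoc₁, sewPart_assoc₂]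
  compat A B C D _ _ _ _ := by
    apply sg_ext₂; intro g h
    simp only [LinearMap.comp_apply, LinearEquiv.coe_coe, sgMul_single, mul_one,
      TensorProduct.tensorTensorTensorComm_tmul,
      sgMap_single, sgComul_single, TensorProduct.map_tmul, ripPart_sum, sewPart_sum]

end SG

/-- The value of a character of the Hopf monoid of graphs on a graph. -/
def Character.onGraph {K : Type w} [Field K] (ζ : Character (graphHopf.{u} K))
    {V : Type u} [Finite V] (g : SimpleGraph V) : K :=
  ζ.toFun V (Finsupp.single g 1 : SimpleGraph V →₀ K)

/-- `χ^ζ_V(g)(n)` for a graph `g`. -/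
def graphChi {K : Type w} [Field K] (ζ : Character (graphHopf.{u} K))
    {V : Type u} [Finite V] (g : SimpleGraph V) (n : ℕ) : K :=
  chi ζ (V := V) (Finsupp.single g 1 : SimpleGraph V →₀ K) n

/-- `ζ` is a characteristic function: its values on graphs are `0` and `1`. -/
def Character.IsCharacteristic {K : Type w} [Field K] (ζ : Character (graphHopf.{u} K)) : Prop :=
  ∀ (V : Type u) [Finite V] (g : SimpleGraph V), ζ.onGraph g = 0 ∨ ζ.onGraph g = 1

/-- `ζ` is odd: the connected graphs on which it is not zero have an odd number of vertices. -/
def Character.IsOdd {K : Type w} [Field K] (ζ : Character (graphHopf.{u} K)) : Prop :=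
  ∀ (V : Type u) [Finite V] (g : SimpleGraph V), g.Connected → ζ.onGraph g ≠ 0 → Odd (Nat.card V)

/-! ### Labelled rooted forests -/

/-- A rooted forest whose nodes are labelled by (and identified with) pairwise disjoint non-empty
subsets of `V`. It is recorded by the relation `le p q`, "`p = q` or `p` is a descendant of `q`",
a partial order on the nodes in which the nodes above a given node form a chain. -/
@[ext] structure LabelledForest (V : Type*) where
  nodes : Set (Set V)
  nonempty : ∀ p ∈ nodes, p.Nonempty
  disjoint : nodes.PairwiseDisjoint id
  le : Set V → Set V → Prop
  mem_of_le : ∀ {p q}, le p q → p ∈ nodes ∧ q ∈ nodes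
  le_refl : ∀ p ∈ nodes, le p p
  le_antisymm : ∀ {p q}, le p q → le q p → p = q
  le_trans : ∀ {p q r}, le p q → le q r → le p r
  le_chain : ∀ {p q r}, le p q → le p r → le q r ∨ le r q

namespace LabelledForest

instance {V : Type*} [Finite V] : Finite (LabelledForest V) :=
  Finite.of_injective
    (fun F => (F.nodes, F.le) : LabelledForest V → Set (Set V) × (Set V → Set V → Prop))
    fun _ _ h => LabelledForest.ext (congrArg Prod.fst h) (congrArg Prod.snd h)

variable {V : Type*}

/-- The set partitioned by the labels. -/
def support (F : LabelledForest V) : Set V := ⋃₀ F.nodes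

/-- `F_{≤ p}`: the union of the nodes that are equal to `p` or descendants of `p`. -/
def below (F : LabelledForest V) (p : Set V) : Set V := ⋃₀ {q | F.le q p}

def IsRoot (F : LabelledForest V) (r : Set V) : Prop := r ∈ F.nodes ∧ ∀ q, F.le r q → q = r

def leaves (F : LabelledForest V) : Set (Set V) := {p | p ∈ F.nodes ∧ ∀ q, F.le q p → q = p}

def deleteLeaves (F : LabelledForest V) : LabelledForest V where
  nodes := F.nodes \ F.leaves
  nonempty p hp := F.nonempty p hp.1
  disjoint := F.disjoint.subset Set.sdiff_subset
  le p q := F.le p q ∧ p ∉ F.leaves ∧ q ∉ F.leaves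
  mem_of_le h := ⟨⟨(F.mem_of_le h.1).1, h.2.1⟩, ⟨(F.mem_of_le h.1).2, h.2.2⟩⟩
  le_refl p hp := ⟨F.le_refl p hp.1, hp.2, hp.2⟩
  le_antisymm h h' := F.le_antisymm h.1 h'.1
  le_trans h h' := ⟨F.le_trans h.1 h'.1, h.2.1, h'.2.2⟩
  le_chain h h' := (F.le_chain h.1 h'.1).imp (fun k => ⟨k, h.2.2, h'.2.2⟩)
    fun k => ⟨k, h'.2.2, h.2.2⟩

/-- `F` is the disjoint union of the forests in the set `S`. -/
def IsDisjointUnion (F : LabelledForest V) (S : Set (LabelledForest V)) : Prop :=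
  F.nodes = {p | ∃ T ∈ S, p ∈ T.nodes} ∧ ∀ p q, F.le p q ↔ ∃ T ∈ S, T.le p q

/-- `F` is the tree with root `W` whose direct subtrees are the trees in the set `S`. -/
def IsGraft (F : LabelledForest V) (W : Set V) (S : Set (LabelledForest V)) : Prop :=
  F.nodes = insert W {p | ∃ T ∈ S, p ∈ T.nodes} ∧
    ∀ p q, F.le p q ↔ (p ∈ F.nodes ∧ q = W) ∨ ∃ T ∈ S, T.le p q

/-- The colouring `c` is compatible with `F`: it is constant on each node, and the induced map
on the nodes is weakly increasing from descendants to ancestors. -/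
def Compatible {n : ℕ} (F : LabelledForest V) (c : V → Fin n) : Prop :=
  (∀ p ∈ F.nodes, ∀ v ∈ p, ∀ v' ∈ p, c v = c v') ∧
    ∀ p q, F.le p q → p ≠ q → ∀ v ∈ p, ∀ v' ∈ q, c v ≤ c v'

/-- The colouring `c` is strictly compatible with `F`: it is constant on each node, and the
induced map on the nodes is strictly increasing from descendants to ancestors. -/
def StrictlyCompatible {n : ℕ} (F : LabelledForest V) (c : V → Fin n) : Prop :=
  (∀ p ∈ F.nodes, ∀ v ∈ p, ∀ v' ∈ p, c v = c v') ∧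
    ∀ p q, F.le p q → p ≠ q → ∀ v ∈ p, ∀ v' ∈ q, c v < c v'

/-- The colourings with `n` colours compatible with `F`. -/
def colorings (F : LabelledForest V) (n : ℕ) : Set (V → Fin n) := {c | F.Compatible c}

/-- The colourings with `n` colours strictly compatible with `F`. -/
def strictColorings (F : LabelledForest V) (n : ℕ) : Set (V → Fin n) := {c | F.StrictlyCompatible c}

end LabelledForest

/-! ### Partitioning forests -/

/-- The vertex sets of the connected components of the subgraph of `g` induced by `U`. -/
def components {V : Type*} (g : SimpleGraph V) (U : Set V) : Set (Set V) :=
  {C | ∃ k : (g.induce U).ConnectedComponent, C = Subtype.val '' k.supp}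

/-- `IsPartitioningTree g U F`: `F` is a partitioning tree of the connected graph induced by `g`
on `U`. One chooses the root `∅ ≠ W ⊆ U` and a partitioning tree `T C` for each connected
component `C` of the graph induced on `U \ W`. When `U` is a singleton the only choice is
`W = U`, which gives the tree with the single node `U`. -/
inductive IsPartitioningTree {V : Type*} (g : SimpleGraph V) : Set V → LabelledForest V → Prop
  | graft (U W : Set V) (T : Set V → LabelledForest V) (F : LabelledForest V)
      (connected : (g.induce U).Connected) (nonempty : W.Nonempty) (subset : W ⊆ U)
      (subtrees : ∀ C ∈ components g (U \ W), IsPartitioningTree g C (T C))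
      (isGraft : F.IsGraft W (T '' components g (U \ W))) : IsPartitioningTree g U F

/-- The set `PF(g)` of partitioning forests of `g`: disjoint unions of one partitioning tree for
each connected component of `g`. -/
def partitioningForests {V : Type*} (g : SimpleGraph V) : Set (LabelledForest V) :=
  {F | ∃ T : Set V → LabelledForest V,
    (∀ C ∈ components g Set.univ, IsPartitioningTree g C (T C)) ∧
      F.IsDisjointUnion (T '' components g Set.univ)}

/-- The subgraph of `g` induced by `p`, the other vertices being kept as isolated vertices. -/
def restrictTo {V : Type*} (g : SimpleGraph V) (p : Set V) : SimpleGraph V where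
  Adj v w := v ∈ p ∧ w ∈ p ∧ g.Adj v w
  symm := ⟨fun _ _ h => ⟨h.2.1, h.1, h.2.2.symm⟩⟩
  loopless := ⟨fun v h => g.loopless.irrefl v h.2.2⟩

/-- `k` rounds of the following process: for each leaf `p` of the forest, collect the graph
induced by `p`; then sew through all the leaves and delete them from the forest. -/
def ripSewRounds {V : Type*} : ℕ → SimpleGraph V → LabelledForest V → SimpleGraph V
  | 0, _, _ => ⊥
  | k + 1, g, F =>
    (⨆ p ∈ F.leaves, restrictTo g p) ⊔ ripSewRounds k (sew g (⋃₀ F.leaves)) F.deleteLeaves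

/-- The graph `g_F` ripped and sewed through `F`. Every round deletes at least one node as long
as there is one, so the forest is empty after as many rounds as there are vertices. -/
def ripSew {V : Type*} (g : SimpleGraph V) (F : LabelledForest V) : SimpleGraph V :=
  ripSewRounds (Nat.card V) g F

/-- The `ζ`-partitioning forests of `g`. -/
def zetaPartitioningForests {K : Type w} [Field K] (ζ : Character (graphHopf.{u} K))
    {V : Type u} [Finite V] (g : SimpleGraph V) : Set (LabelledForest V) :=
  {F | F ∈ partitioningForests g ∧ ζ.onGraph (ripSew g F) ≠ 0}

/-- The number of connected components of a graph. -/
def cc {V : Type*} (g : SimpleGraph V) : ℕ := Nat.card g.ConnectedComponent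

/-! ### Building sets -/

/-- A building set on `V`; its elements are called connected sets. -/
structure BuildingSet (V : Type*) where
  sets : Set (Set V)
  nonempty : ∀ I ∈ sets, I.Nonempty
  union : ∀ I ∈ sets, ∀ J ∈ sets, (I ∩ J).Nonempty → I ∪ J ∈ sets
  singleton : ∀ v : V, {v} ∈ sets

/-- The graphical building set of `g`: its elements are the sets inducing connected subgraphs. -/
def tubes {V : Type*} (g : SimpleGraph V) : BuildingSet V where
  sets := {I | (g.induce I).Connected}
  nonempty I hI := by
    obtain ⟨v⟩ := hI.nonempty
    exact ⟨v, v.2⟩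
  union I hI J hJ h := SimpleGraph.induce_union_connected hI.preconnected hJ.preconnected h
  singleton v := by
    have : Nonempty ({v} : Set V) := ⟨⟨v, rfl⟩⟩
    exact ⟨SimpleGraph.Preconnected.of_subsingleton⟩

/-- The set of `B`-forests: forests labelled by a partition of `V` such that, for every root `r`,
`F_{≤ r}` is the vertex set of a connected component of `B` (a maximal connected set); for every
node `p`, `F_{≤ p}` is connected; and for any at least two pairwise incomparable nodes, the union
of the sets `F_{≤ p}` is not connected. -/
def buildingForests {V : Type*} (B : BuildingSet V) : Set (LabelledForest V) :=
  {F | F.support = Set.univ ∧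
    (∀ r, F.IsRoot r → Maximal (fun I => I ∈ B.sets) (F.below r)) ∧
    (∀ p ∈ F.nodes, F.below p ∈ B.sets) ∧
    ∀ A ⊆ F.nodes, A.Nontrivial → (A.Pairwise fun p q => ¬ F.le p q) →
      (⋃ p ∈ A, F.below p) ∉ B.sets}

end RipSew

end

noncomputable section

namespace RipSew

/-! ### Order polynomials of forests -/

/-! Every colouring `c : V → [n]` is strictly compatible with exactly one partitioning forest. Let
the reach of a vertex `v` be its component in the graph induced by the colours at most `c v`. Two
reaches are nested or disjoint. The node of `v` consists of the vertices of colour `c v` in its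
reach, and nodes are ordered by inclusion of reaches (`colorForest`, `Nested.eq_colorForest`).

Since sewing through `A` and then through `B` is sewing through `A ∪ B`, the map `μ ∘ Δ` attached to
`c` sends `g` to the graph joining two vertices of equal colour when a path through smaller colours
connects them (`mulComul_graphVector`). This graph depends only on the forest: within `F_{≤ p}`, the
colours smaller than that of `p` are those of the proper descendants of `p`
(`Nested.colorGraph_le`). Colouring each node by the round that deletes it is strictly compatible
and produces `g_F`, so the graph is `g_F` (`Nested.ripSew_eq`). Grouping the colourings by their
forest gives the first formula.

Strict colourings of a rooted forest are counted by a polynomial whose value at `-n` is the number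
of weak colourings times the sign `(-1) ^ #nodes` (`exists_orderPolynomial`): disjoint unions
multiply, and adding a root is a discrete summation. The components of `g_F` correspond to the nodes
of `F` (`cc_colorGraph`), which identifies the sign. If `ζ` is odd and does not vanish on `g_F`, all
components of `g_F` have odd size, so the sign is `(-1) ^ |V|`.

Partitioning forests and `B`-forests are both characterized by `Nested`: the nodes partition `V`,
each `F_{≤ p}` is connected, and adjacent vertices lie in comparable nodes. -/

open Polynomial in
theorem exists_antidifference (Q : ℚ[X]) :
    ∃ P : ℚ[X], P.eval 0 = 0 ∧ ∀ x, P.eval (x + 1) = P.eval x + Q.eval x := by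
  induction Q using Polynomial.induction_on' with
  | add p q hp hq =>
    obtain ⟨P, h1, h2⟩ := hp
    obtain ⟨P', h1', h2'⟩ := hq
    refine ⟨P + P', by simp [h1, h1'], fun x => ?_⟩
    rw [eval_add, eval_add, eval_add, h2, h2']
    ring
  | monomial n a =>
    -- The Bernoulli polynomials satisfy `B (x + 1) - B x = (n + 1) * x ^ n` in degree `n + 1`;
    -- subtracting the constant term makes the antidifference vanish at `0`.
    refine ⟨C (a / (n + 1)) * (Polynomial.bernoulli (n + 1) - C ((Polynomial.bernoulli (n + 1)).eval 0)),
      by simp, fun x => ?_⟩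
    have h := bernoulli_eval_one_add (n + 1) x
    have hn : (n + 1 : ℚ) ≠ 0 := by positivity
    simp only [eval_mul, eval_C, eval_sub, eval_monomial]
    rw [add_comm x 1, h]
    push_cast
    field_simp
    ring

/-- The colourings of a poset by natural numbers less than `n` for which the colours of
any `x < y` are in the relation `r`. -/
def relColorings (α : Type*) [Preorder α] (r : ℕ → ℕ → Prop) (n : ℕ) : Set (α → ℕ) :=
  {c | (∀ x y, x < y → r (c x) (c y)) ∧ ∀ x, c x < n}

instance {α : Type*} [Preorder α] [Finite α] (r : ℕ → ℕ → Prop) (n : ℕ) :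
    Finite (relColorings α r n) :=
  Finite.of_injective (β := α → Fin n) (fun c x => ⟨c.1 x, c.2.2 x⟩) fun _ _ h =>
    Subtype.ext (funext fun x => congrArg Fin.val (congrFun h x))

/-- Splitting a colouring of a poset with two unrelated parts. -/
def relColoringsProd {α : Type*} [Preorder α] (r : ℕ → ℕ → Prop) (n : ℕ) (p : α → Prop)
    [DecidablePred p] (hp : ∀ x y, x < y → (p x ↔ p y)) :
    relColorings α r n ≃ relColorings {x // p x} r n × relColorings {x // ¬ p x} r n where
  toFun c := (⟨fun x => c.1 x, fun x y h => c.2.1 x y h, fun x => c.2.2 x⟩,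
    ⟨fun x => c.1 x, fun x y h => c.2.1 x y h, fun x => c.2.2 x⟩)
  invFun d := ⟨fun x => if h : p x then d.1.1 ⟨x, h⟩ else d.2.1 ⟨x, h⟩, by
    refine ⟨fun x y h => ?_, fun x => ?_⟩
    · by_cases hx : p x
      · have hy := (hp x y h).1 hx
        simp only [hx, hy, dif_pos]
        exact d.1.2.1 ⟨x, hx⟩ ⟨y, hy⟩ h
      · have hy : ¬ p y := fun hy => hx ((hp x y h).2 hy)
        simp only [hx, hy, dif_neg, not_false_eq_true]
        exact d.2.2.1 ⟨x, hx⟩ ⟨y, hy⟩ h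
    · dsimp only
      split_ifs with hx
      · exact d.1.2.2 _
      · exact d.2.2.2 _⟩
  left_inv c := by
    ext x
    simp
  right_inv d := by
    refine Prod.ext (Subtype.ext (funext fun x => ?_)) (Subtype.ext (funext fun x => ?_))
    · simp [x.2]
    · simp [x.2]

/-- Removing the greatest element of a poset from a colouring. -/
def relColoringsTop {α : Type*} [PartialOrder α] [DecidableEq α] (r : ℕ → ℕ → Prop)
    (s : ℕ → ℕ) (hr : ∀ a b, r a b ↔ a < s b) (hs : ∀ b, s b ≤ b + 1) (n : ℕ) (t : α)
    (ht : ∀ x, x ≤ t) :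
    relColorings α r n ≃ Σ k : Fin n, relColorings {x // x ≠ t} r (s k) where
  toFun c := ⟨⟨c.1 t, c.2.2 t⟩, fun x => c.1 x, fun x y h => c.2.1 x y h,
    fun x => (hr _ _).1 (c.2.1 x t (lt_of_le_of_ne (ht _) x.2))⟩
  invFun d := ⟨fun x => if h : x = t then d.1 else d.2.1 ⟨x, h⟩, by
    refine ⟨fun x y h => ?_, fun x => ?_⟩
    · have hx : x ≠ t := fun e => absurd (ht y) (not_le_of_gt (e ▸ h))
      by_cases hy : y = t
      · simp only [hx, hy, dif_neg, dif_pos, not_false_eq_true]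
        exact (hr _ _).2 (d.2.2.2 _)
      · simp only [hx, hy, dif_neg, not_false_eq_true]
        exact d.2.2.1 _ _ h
    · dsimp only
      split_ifs with hx
      · exact d.1.2
      · have h1 := d.2.2.2 ⟨x, hx⟩
        have h2 := hs d.1
        have h3 := d.1.2
        omega⟩
  left_inv c := by
    ext x
    by_cases h : x = t
    · simp [h]
    · simp [h]
  right_inv d := by
    obtain ⟨k, d⟩ := d
    refine Sigma.ext (Fin.ext (by simp)) ?_
    -- The second component has a type depending on the colour of `t`; generalizing that colour
    -- turns the heterogeneous equality into an ordinary one.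
    have : ∀ (k' : Fin n) (d' : relColorings {x // x ≠ t} r (s k')), k' = k → d'.1 = d.1 →
        HEq d' d := by
      rintro k' d' rfl h
      exact heq_of_eq (Subtype.ext h)
    refine this _ _ (Fin.ext (by simp)) (funext fun x => ?_)
    simp [x.2]

/-- Sort the colourings by the colour `k` of the greatest element: the rest is coloured below `s k`.
Strict colourings correspond to `s = id`, weak ones to `s = Nat.succ`; the bound `s k ≤ k + 1` keeps
all colours below `n`. -/
theorem card_relColorings_top {α : Type*} [PartialOrder α] [Finite α] (r : ℕ → ℕ → Prop)
    (s : ℕ → ℕ) (hr : ∀ a b, r a b ↔ a < s b) (hs : ∀ b, s b ≤ b + 1) (n : ℕ) (t : α)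
    (ht : ∀ x, x ≤ t) :
    Nat.card (relColorings α r n) =
      ∑ k ∈ Finset.range n, Nat.card (relColorings {x // x ≠ t} r (s k)) := by
  classical
  rw [Nat.card_congr (relColoringsTop r s hr hs n t ht), Nat.card_sigma,
    Finset.sum_range fun k => Nat.card (relColorings {x // x ≠ t} r (s k))]

/-- The order polynomial of a finite forest, with its reciprocity. -/
theorem exists_orderPolynomial (m : ℕ) : ∀ (α : Type u) [PartialOrder α] [Finite α],
    Nat.card α = m → (∀ x y z : α, x ≤ y → x ≤ z → y ≤ z ∨ z ≤ y) →
    ∃ P : Polynomial ℚ, (∀ n : ℕ, P.eval (n : ℚ) = Nat.card (relColorings α (· < ·) n)) ∧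
      ∀ n : ℕ, P.eval (-(n : ℚ)) = (-1) ^ m * Nat.card (relColorings α (· ≤ ·) n) := by
  induction m using Nat.strong_induction_on with
  | _ m ih =>
    intro α _ _ hm hα
    classical
    rcases isEmpty_or_nonempty α with he | hne
    · have h : ∀ r n, Nat.card (relColorings α r n) = 1 := by
        intro r n
        have : Nonempty (relColorings α r n) :=
          ⟨⟨fun x => (he.false x).elim, fun x => (he.false x).elim, fun x => (he.false x).elim⟩⟩
        have : Subsingleton (relColorings α r n) :=
          ⟨fun c d => Subtype.ext (funext fun x => (he.false x).elim)⟩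
        exact Nat.card_unique
      have hm0 : m = 0 := by rw [← hm]; exact Nat.card_of_isEmpty
      refine ⟨1, fun n => ?_, fun n => ?_⟩
      · rw [h, Polynomial.eval_one, Nat.cast_one]
      · rw [h, Polynomial.eval_one, Nat.cast_one, hm0, pow_zero, one_mul]
    · obtain ⟨t, -, ht⟩ := (Set.finite_univ (α := α)).exists_maximal Set.univ_nonempty
      have ht : ∀ x, t ≤ x → x ≤ t := fun x => ht (Set.mem_univ x)
      -- Either the maximal element `t` is the greatest, and the poset is a tree whose root is
      -- removed, or the elements below `t` split off as a disjoint part.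
      by_cases htop : ∀ x, x ≤ t
      · have hcard : Nat.card {x // x ≠ t} + 1 = m := by
          rw [← hm, ← Set.ncard_univ α, ← Set.ncard_sdiff_singleton_add_one (Set.mem_univ t)]
          congr 1
          rw [← Nat.card_coe_set_eq]
          exact Nat.card_congr (Equiv.subtypeEquivRight fun x => by simp)
        obtain ⟨Q, hQ, hQ'⟩ := ih _ (by omega) {x // x ≠ t} rfl fun x y z => hα x y z
        obtain ⟨P, hP0, hP⟩ := exists_antidifference Q
        refine ⟨P, fun n => ?_, fun n => ?_⟩
        · rw [card_relColorings_top (· < ·) id (fun _ _ => Iff.rfl) (fun b => Nat.le_succ b) n t htop]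
          induction n with
          | zero => simp [hP0]
          | succ n ihn =>
            rw [Finset.sum_range_succ]
            push_cast at ihn ⊢
            rw [← ihn, hP, hQ]
            rfl
        · rw [card_relColorings_top _ Nat.succ (fun _ _ => Nat.lt_succ_iff.symm)
            (fun b => le_rfl) n t htop]
          induction n with
          | zero => simp [hP0]
          | succ n ihn =>
            -- The difference equation at `-(n + 1)` reads `P (-n) = P (-(n + 1)) + Q (-(n + 1))`.
            -- Solving for `P (-(n + 1))` adds one term to the weak count and supplies the extra
            -- sign of the root.
            have h1 := hP (-((n + 1 : ℕ) : ℚ))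
            rw [hQ', show -((n + 1 : ℕ) : ℚ) + 1 = -(n : ℚ) by push_cast; ring, ihn] at h1
            rw [Finset.sum_range_succ, ← hcard, pow_succ]
            rw [← hcard, pow_succ] at h1
            push_cast [Nat.succ_eq_add_one] at h1 ⊢
            linear_combination -h1
      -- Here the chain condition enters: if `x ≤ t` and `x < y`, then `y` is comparable to `t`,
      -- hence below it by maximality.
      · have hp : ∀ x y, x < y → (x ≤ t ↔ y ≤ t) := fun x y hxy =>
          ⟨fun h => (hα x y t hxy.le h).elim id (ht y), fun h => hxy.le.trans h⟩
        push Not at htop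
        obtain ⟨a, ha⟩ := htop
        have hcard : Nat.card {x // x ≤ t} + Nat.card {x // ¬ x ≤ t} = m := by
          rw [← hm, ← Nat.card_sum, Nat.card_congr (Equiv.sumCompl fun x => x ≤ t)]
        have h1 : 0 < Nat.card {x // x ≤ t} :=
          Nat.card_pos_iff.2 ⟨⟨t, le_rfl⟩, inferInstance⟩
        have h2 : 0 < Nat.card {x // ¬ x ≤ t} :=
          Nat.card_pos_iff.2 ⟨⟨a, ha⟩, inferInstance⟩
        obtain ⟨P, hP, hP'⟩ := ih _ (by omega) {x // x ≤ t} rfl fun x y z => hα x y z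
        obtain ⟨Q, hQ, hQ'⟩ := ih _ (by omega) {x // ¬ x ≤ t} rfl fun x y z => hα x y z
        refine ⟨P * Q, fun n => ?_, fun n => ?_⟩
        · rw [Nat.card_congr (relColoringsProd _ n (fun x => x ≤ t) hp), Nat.card_prod,
            Polynomial.eval_mul, hP, hQ, Nat.cast_mul]
        · rw [Nat.card_congr (relColoringsProd _ n (fun x => x ≤ t) hp), Nat.card_prod,
            Polynomial.eval_mul, hP', hQ', Nat.cast_mul, ← hcard, pow_add]
          ring

/-! ### Connected sets and components -/

section Components

variable {V : Type*} {g : SimpleGraph V} {U C C' I : Set V}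

/-- Induction along a walk in `I`. The proofs below confine a connected set by checking only the
edges that lead from `A` into `I`. -/
theorem subset_of_preconnected {A : Set V} {x : V} (hI : (g.induce I).Preconnected)
    (hx : x ∈ I) (hxA : x ∈ A) (h : ∀ u ∈ A, ∀ v ∈ I, g.Adj u v → v ∈ A) : I ⊆ A := by
  intro y hy
  obtain ⟨p⟩ := hI ⟨x, hx⟩ ⟨y, hy⟩
  have : ∀ (a b : I) (_ : (g.induce I).Walk a b), a.1 ∈ A → b.1 ∈ A := by
    intro a b p
    induction p with
    | nil => exact id
    | @cons a b c e _ ih => exact fun ha => ih (h _ ha _ b.2 e)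
  exact this _ _ p hxA

theorem subset_of_mem_components (hC : C ∈ components g U) : C ⊆ U := by
  obtain ⟨k, rfl⟩ := hC
  rintro _ ⟨x, -, rfl⟩
  exact x.2

theorem connected_of_mem_components (hC : C ∈ components g U) : (g.induce C).Connected := by
  obtain ⟨k, rfl⟩ := hC
  have e : (g.induce U).induce k.supp ≃g g.induce (Subtype.val '' k.supp) :=
    { toEquiv := Equiv.Set.image _ _ Subtype.val_injective
      map_rel_iff' := Iff.rfl }
  exact e.connected_iff.1 k.connected_toSimpleGraph

theorem exists_mem_components {v : V} (hv : v ∈ U) : ∃ C ∈ components g U, v ∈ C :=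
  ⟨_, ⟨(g.induce U).connectedComponentMk ⟨v, hv⟩, rfl⟩, ⟨v, hv⟩, rfl, rfl⟩

theorem mem_component_of_adj (hC : C ∈ components g U) {u v : V} (hu : u ∈ C) (hv : v ∈ U)
    (h : g.Adj u v) : v ∈ C := by
  obtain ⟨k, rfl⟩ := hC
  obtain ⟨u, hk, rfl⟩ := hu
  have h' : (g.induce U).Adj u ⟨v, hv⟩ := h
  exact ⟨⟨v, hv⟩, by
    rw [SimpleGraph.ConnectedComponent.mem_supp_iff] at hk ⊢
    rw [← hk]
    exact (SimpleGraph.ConnectedComponent.connectedComponentMk_eq_of_adj h').symm, rfl⟩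

theorem subset_component (hC : C ∈ components g U) (hI : (g.induce I).Preconnected)
    (hIU : I ⊆ U) {x : V} (hx : x ∈ I) (hxC : x ∈ C) : I ⊆ C :=
  subset_of_preconnected hI hx hxC fun _ hu _ hv h => mem_component_of_adj hC hu (hIU hv) h

theorem component_eq (hC : C ∈ components g U) (hC' : C' ∈ components g U) {x : V}
    (hx : x ∈ C) (hx' : x ∈ C') : C = C' :=
  (subset_component hC' (connected_of_mem_components hC).preconnected
    (subset_of_mem_components hC) hx hx').antisymm
  (subset_component hC (connected_of_mem_components hC').preconnected
    (subset_of_mem_components hC') hx' hx)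

end Components

/-! ### Forests nested in a graph -/

namespace LabelledForest

variable {V : Type*} {F : LabelledForest V} {p q : Set V} {v : V}

/-- The type of nodes of a forest. -/
def Node (F : LabelledForest V) : Type _ := {p // p ∈ F.nodes}

instance [Finite V] : Finite F.Node := inferInstanceAs (Finite {p // p ∈ F.nodes})

/-- The nodes of a forest are ordered from descendants to ancestors. -/
instance : PartialOrder F.Node where
  le p q := F.le p.1 q.1
  le_refl p := F.le_refl p.1 p.2
  le_trans _ _ _ h h' := F.le_trans h h'
  le_antisymm _ _ h h' := Subtype.ext (F.le_antisymm h h')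

theorem node_eq (hp : p ∈ F.nodes) (hq : q ∈ F.nodes) (hvp : v ∈ p) (hvq : v ∈ q) : p = q :=
  F.disjoint.elim_set hp hq v hvp hvq

theorem subset_below (hp : p ∈ F.nodes) : p ⊆ F.below p := fun _ hv => ⟨p, F.le_refl p hp, hv⟩

theorem below_subset_support : F.below p ⊆ F.support := by
  rintro v ⟨r, hr, hv⟩
  exact ⟨r, (F.mem_of_le hr).1, hv⟩

theorem le_of_mem_below (hq : q ∈ F.nodes) (hv : v ∈ q) (h : v ∈ F.below p) : F.le q p := by
  obtain ⟨r, hr, hvr⟩ := h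
  rwa [node_eq hq (F.mem_of_le hr).1 hv hvr]

/-- The forest formed by the nodes of `F` in the set `A`. -/
def restrict (F : LabelledForest V) (A : Set (Set V)) : LabelledForest V where
  nodes := F.nodes ∩ A
  nonempty p hp := F.nonempty p hp.1
  disjoint := F.disjoint.subset Set.inter_subset_left
  le p q := F.le p q ∧ p ∈ A ∧ q ∈ A
  mem_of_le h := ⟨⟨(F.mem_of_le h.1).1, h.2.1⟩, ⟨(F.mem_of_le h.1).2, h.2.2⟩⟩
  le_refl p hp := ⟨F.le_refl p hp.1, hp.2, hp.2⟩
  le_antisymm h h' := F.le_antisymm h.1 h'.1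
  le_trans h h' := ⟨F.le_trans h.1 h'.1, h.2.1, h'.2.2⟩
  le_chain h h' := (F.le_chain h.1 h'.1).imp (fun k => ⟨k, h.2.2, h'.2.2⟩)
    fun k => ⟨k, h'.2.2, h.2.2⟩

theorem below_restrict {A : Set (Set V)} (hp : p ∈ A) (h : ∀ q, F.le q p → q ∈ A) :
    (F.restrict A).below p = F.below p := by
  ext v
  constructor
  · rintro ⟨q, hq, hv⟩
    exact ⟨q, hq.1, hv⟩
  · rintro ⟨q, hq, hv⟩
    exact ⟨q, ⟨hq, h q hq, hp⟩, hv⟩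

end LabelledForest

open LabelledForest

/-- The nodes of `F` partition `U`, the sets `F_{≤ p}` are connected, and adjacent vertices
belong to comparable nodes. -/
structure Nested {V : Type*} (g : SimpleGraph V) (U : Set V) (F : LabelledForest V) : Prop where
  support : F.support = U
  connected : ∀ p ∈ F.nodes, (g.induce (F.below p)).Connected
  comparable : ∀ p ∈ F.nodes, ∀ q ∈ F.nodes, ∀ u ∈ p, ∀ v ∈ q, g.Adj u v → F.le p q ∨ F.le q p

section Nested

variable {V : Type*} {g : SimpleGraph V} {U W : Set V} {F : LabelledForest V} {p q : Set V}

theorem Nested.exists_node (h : Nested g U F) {v : V} (hv : v ∈ U) : ∃ p ∈ F.nodes, v ∈ p := by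
  rw [← h.support] at hv
  exact hv

theorem Nested.subset (h : Nested g U F) (hp : p ∈ F.nodes) : p ⊆ U := by
  rw [← h.support]
  exact Set.subset_sUnion_of_mem hp

/-- A node comparable to a descendant of `p` is either below that descendant or, by the chain
condition, comparable to `p`. -/
theorem Nested.le_or_le_of_adj (h : Nested g U F) (hq : q ∈ F.nodes) {u v : V}
    (hu : u ∈ F.below p) (hv : v ∈ q) (e : g.Adj u v) : F.le q p ∨ F.le p q := by
  obtain ⟨p', hp', hu⟩ := hu
  rcases h.comparable p' (F.mem_of_le hp').1 q hq u hu v hv e with h1 | h1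
  · exact F.le_chain h1 hp'
  · exact .inl (F.le_trans h1 hp')

/-- No edge within `U` leaves `F_{≤ W}`: it would end in a node comparable to the root `W`, hence
below it. -/
theorem Nested.subset_below_of_isRoot (h : Nested g U F) (hW : F.IsRoot W) {I : Set V}
    (hI : (g.induce I).Preconnected) (hIU : I ⊆ U) {x : V} (hx : x ∈ I) (hxW : x ∈ F.below W) :
    I ⊆ F.below W := by
  refine subset_of_preconnected hI hx hxW fun u hu v hv e => ?_
  obtain ⟨q, hq, hvq⟩ := h.exists_node (hIU hv)
  rcases h.le_or_le_of_adj hq hu hvq e with h1 | h1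
  · exact ⟨q, h1, hvq⟩
  · have := hW.2 q h1
    subst this
    exact subset_below hq hvq

theorem Nested.exists_component (h : Nested g U F) (hp : p ∈ F.nodes) :
    ∃ C ∈ components g U, F.below p ⊆ C := by
  obtain ⟨x, hx⟩ := F.nonempty p hp
  obtain ⟨C, hC, hxC⟩ := exists_mem_components (g := g) (h.subset hp hx)
  refine ⟨C, hC, subset_component hC (h.connected p hp).preconnected ?_ (subset_below hp hx) hxC⟩
  rw [← h.support]
  exact below_subset_support

theorem Nested.below_subset (h : Nested g U F) (hp : p ∈ F.nodes) {C : Set V}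
    (hC : C ∈ components g U) (hpC : p ⊆ C) : F.below p ⊆ C := by
  obtain ⟨C', hC', hb⟩ := h.exists_component hp
  obtain ⟨x, hx⟩ := F.nonempty p hp
  rwa [component_eq hC hC' (hpC hx) (hb (subset_below hp hx))]

theorem subset_below_of_le (h : F.le q p) : q ⊆ F.below p := fun _ hv => ⟨q, h, hv⟩

theorem Nested.restrict_component (h : Nested g U F) {C : Set V} (hC : C ∈ components g U) :
    Nested g C (F.restrict {p | p ⊆ C}) where
  support := by
    refine Set.Subset.antisymm ?_ fun v hv => ?_
    · rintro v ⟨p, hp, hv⟩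
      exact hp.2 hv
    · obtain ⟨p, hp, hvp⟩ := h.exists_node (subset_of_mem_components hC hv)
      obtain ⟨C', hC', hb⟩ := h.exists_component hp
      have := component_eq hC hC' hv (hb (subset_below hp hvp))
      subst this
      exact ⟨p, ⟨hp, (subset_below hp).trans hb⟩, hvp⟩
  connected p hp := by
    rw [below_restrict hp.2 fun q hq => (subset_below_of_le hq).trans
      (h.below_subset hp.1 hC hp.2)]
    exact h.connected p hp.1
  comparable p hp q hq u hu v hv e :=
    (h.comparable p hp.1 q hq.1 u hu v hv e).imp (fun k => ⟨k, hp.2, hq.2⟩)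
      fun k => ⟨k, hq.2, hp.2⟩

theorem Nested.isDisjointUnion (h : Nested g U F) :
    F.IsDisjointUnion ((fun C => F.restrict {p | p ⊆ C}) '' components g U) := by
  constructor
  · ext p
    constructor
    · intro hp
      obtain ⟨C, hC, hb⟩ := h.exists_component hp
      exact ⟨_, ⟨C, hC, rfl⟩, hp, (subset_below hp).trans hb⟩
    · rintro ⟨_, ⟨C, hC, rfl⟩, hp⟩
      exact hp.1
  · intro p q
    constructor
    · intro hpq
      have hq := (F.mem_of_le hpq).2
      obtain ⟨C, hC, hb⟩ := h.exists_component hq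
      exact ⟨_, ⟨C, hC, rfl⟩, hpq, (subset_below_of_le hpq).trans hb, (subset_below hq).trans hb⟩
    · rintro ⟨_, ⟨C, hC, rfl⟩, hp⟩
      exact hp.1

/-- A nonempty node determines its component, so the trees do not interfere; adjacent vertices of
`U` share a component, so comparability is checked within a single tree. -/
theorem nested_of_isDisjointUnion {T : Set V → LabelledForest V}
    (hT : ∀ C ∈ components g U, Nested g C (T C))
    (hF : F.IsDisjointUnion (T '' components g U)) : Nested g U F := by
  have hn : ∀ {p}, p ∈ F.nodes ↔ ∃ C ∈ components g U, p ∈ (T C).nodes := by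
    intro p
    rw [hF.1]
    simp
  have hle : ∀ {p q}, F.le p q ↔ ∃ C ∈ components g U, (T C).le p q := by
    intro p q
    rw [hF.2]
    simp
  have huniq : ∀ {p C C'}, C ∈ components g U → C' ∈ components g U → p ∈ (T C).nodes →
      p ∈ (T C').nodes → C = C' := by
    intro p C C' hC hC' hp hp'
    obtain ⟨x, hx⟩ := (T C).nonempty p hp
    exact component_eq hC hC' ((hT C hC).subset hp hx) ((hT C' hC').subset hp' hx)
  refine ⟨Set.Subset.antisymm ?_ fun v hv => ?_, fun p hp => ?_, fun p hp q hq u hu v hv e => ?_⟩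
  · rintro v ⟨p, hp, hv⟩
    obtain ⟨C, hC, hp⟩ := hn.1 hp
    exact subset_of_mem_components hC ((hT C hC).subset hp hv)
  · obtain ⟨C, hC, hvC⟩ := exists_mem_components (g := g) hv
    obtain ⟨p, hp, hvp⟩ := (hT C hC).exists_node hvC
    exact ⟨p, hn.2 ⟨C, hC, hp⟩, hvp⟩
  · obtain ⟨C, hC, hp⟩ := hn.1 hp
    have : F.below p = (T C).below p := by
      ext v
      constructor
      · rintro ⟨q, hq, hv⟩
        obtain ⟨C', hC', hq⟩ := hle.1 hq
        rw [huniq hC hC' hp ((T C').mem_of_le hq).2]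
        exact ⟨q, hq, hv⟩
      · rintro ⟨q, hq, hv⟩
        exact ⟨q, hle.2 ⟨C, hC, hq⟩, hv⟩
    rw [this]
    exact (hT C hC).connected p hp
  · obtain ⟨C, hC, hp⟩ := hn.1 hp
    obtain ⟨C', hC', hq⟩ := hn.1 hq
    have hv' := (hT C' hC').subset hq hv
    have hvC := mem_component_of_adj hC ((hT C hC).subset hp hu) (subset_of_mem_components hC' hv') e
    have := component_eq hC hC' hvC hv'
    subst this
    exact ((hT C hC).comparable p hp q hq u hu v hv e).imp (fun k => hle.2 ⟨C, hC, k⟩)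
      fun k => hle.2 ⟨C, hC, k⟩

/-- The top node lies below no other node, so deleting it leaves all other sets `F_{≤ p}` unchanged.
-/
theorem Nested.erase (h : Nested g U F) (hW : ∀ p ∈ F.nodes, F.le p W) :
    Nested g (U \ W) (F.restrict {W}ᶜ) where
  support := by
    ext v
    constructor
    · rintro ⟨p, ⟨hp, hpW⟩, hv⟩
      refine ⟨h.subset hp hv, fun hvW => hpW ?_⟩
      exact node_eq hp (F.mem_of_le (hW p hp)).2 hv hvW
    · rintro ⟨hv, hvW⟩
      obtain ⟨p, hp, hvp⟩ := h.exists_node hv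
      refine ⟨p, ⟨hp, ?_⟩, hvp⟩
      rintro rfl
      exact hvW hvp
  connected p hp := by
    rw [below_restrict hp.2]
    · exact h.connected p hp.1
    · rintro q hq rfl
      exact hp.2 (F.le_antisymm (hW p hp.1) hq)
  comparable p hp q hq u hu v hv e :=
    (h.comparable p hp.1 q hq.1 u hu v hv e).imp (fun k => ⟨k, hp.2, hq.2⟩)
      fun k => ⟨k, hq.2, hp.2⟩

theorem nested_of_isGraft {T : Set V → LabelledForest V} (hU : (g.induce U).Connected)
    (hWU : W ⊆ U) (hT : ∀ C ∈ components g (U \ W), Nested g C (T C))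
    (hF : F.IsGraft W (T '' components g (U \ W))) : Nested g U F := by
  have hWn : W ∈ F.nodes := by rw [hF.1]; exact Set.mem_insert _ _
  have hWT : ∀ C ∈ components g (U \ W), W ∉ (T C).nodes := by
    intro C hC hW
    obtain ⟨x, hx⟩ := (T C).nonempty W hW
    exact (subset_of_mem_components hC ((hT C hC).subset hW hx)).2 hx
  have hle : ∀ p ∈ F.nodes, F.le p W := fun p hp => (hF.2 p W).2 (.inl ⟨hp, rfl⟩)
  -- Without its root, the grafted tree is the disjoint union of the subtrees. It remains to put
  -- back `W`, which is comparable to every node and satisfies `F_{≤ W} = U`.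
  have h : Nested g (U \ W) (F.restrict {W}ᶜ) := by
    refine nested_of_isDisjointUnion hT ⟨?_, fun p q => ?_⟩
    · ext p
      change p ∈ F.nodes ∧ p ≠ W ↔ _
      rw [hF.1]
      constructor
      · rintro ⟨h1, h2⟩
        exact h1.resolve_left h2
      · rintro ⟨_, ⟨C, hC, rfl⟩, hp⟩
        refine ⟨.inr ⟨_, ⟨C, hC, rfl⟩, hp⟩, ?_⟩
        rintro rfl
        exact hWT C hC hp
    · change F.le p q ∧ p ≠ W ∧ q ≠ W ↔ _
      rw [hF.2]
      constructor
      · rintro ⟨h1, -, h2⟩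
        exact h1.resolve_left fun h => h2 h.2
      · rintro ⟨_, ⟨C, hC, rfl⟩, hpq⟩
        refine ⟨.inr ⟨_, ⟨C, hC, rfl⟩, hpq⟩, ?_, ?_⟩
        · rintro rfl
          exact hWT C hC ((T C).mem_of_le hpq).1
        · rintro rfl
          exact hWT C hC ((T C).mem_of_le hpq).2
  have hsupp : F.support = U := by
    refine Set.Subset.antisymm ?_ fun v hv => ?_
    · rintro v ⟨p, hp, hv⟩
      by_cases hpW : p = W
      · exact hWU (hpW ▸ hv)
      · exact (h.subset (p := p) ⟨hp, hpW⟩ hv).1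
    · by_cases hvW : v ∈ W
      · exact ⟨W, hWn, hvW⟩
      · obtain ⟨p, hp, hvp⟩ := h.exists_node ⟨hv, hvW⟩
        exact ⟨p, hp.1, hvp⟩
  refine ⟨hsupp, fun p hp => ?_, fun p hp q hq u hu v hv e => ?_⟩
  · by_cases hpW : p = W
    · subst hpW
      have : F.below p = U := by
        rw [← hsupp]
        refine below_subset_support.antisymm ?_
        rintro v ⟨q, hq, hv⟩
        exact ⟨q, hle q hq, hv⟩
      rwa [this]
    · rw [← below_restrict (A := {W}ᶜ) hpW]
      · exact h.connected p ⟨hp, hpW⟩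
      · rintro q hq rfl
        exact hpW (F.le_antisymm (hle p hp) hq)
  · by_cases hqW : q = W
    · exact .inl (hqW ▸ hle p hp)
    · by_cases hpW : p = W
      · exact .inr (hpW ▸ hle q hq)
      · exact (h.comparable p ⟨hp, hpW⟩ q ⟨hq, hqW⟩ u hu v hv e).imp And.left And.left

/-- A maximal node is a root, and the connected set `U` meets what lies below it, hence is contained
in it. -/
theorem Nested.exists_top [Finite V] (h : Nested g U F) (hU : (g.induce U).Connected) :
    ∃ W ∈ F.nodes, ∀ p ∈ F.nodes, F.le p W := by
  obtain ⟨x, hx⟩ := hU.nonempty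
  obtain ⟨p, hp, hxp⟩ := h.exists_node hx
  obtain ⟨W, -, hW⟩ := (Set.finite_univ (α := F.Node)).exists_maximal ⟨⟨p, hp⟩, trivial⟩
  obtain ⟨y, hy⟩ := F.nonempty W.1 W.2
  have hroot : F.IsRoot W.1 := ⟨W.2, fun q hq =>
    F.le_antisymm (hW (y := ⟨q, (F.mem_of_le hq).2⟩) trivial hq) hq⟩
  have hsub := h.subset_below_of_isRoot hroot hU.preconnected le_rfl (h.subset W.2 hy)
    (subset_below W.2 hy)
  refine ⟨W.1, W.2, fun q hq => ?_⟩
  obtain ⟨z, hz⟩ := F.nonempty q hq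
  exact le_of_mem_below hq hz (hsub (h.subset hq hz))

theorem IsPartitioningTree.nested (h : IsPartitioningTree g U F) : Nested g U F := by
  induction h with
  | graft U W T F hU hW hWU _ hF ih => exact nested_of_isGraft hU hWU ih hF

/-- Strong induction on the size of `U`: the top node is the root, and the components left after
removing it are strictly smaller because it is nonempty. -/
theorem Nested.isPartitioningTree [Finite V] (n : ℕ) : ∀ {U : Set V} {F : LabelledForest V},
    U.ncard = n → Nested g U F → (g.induce U).Connected → IsPartitioningTree g U F := by
  induction n using Nat.strong_induction_on with
  | _ n ih =>
    intro U F hn h hU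
    obtain ⟨W, hW, hle⟩ := h.exists_top hU
    have he := h.erase hle
    have hne := F.nonempty W hW
    have hWU := h.subset hW
    refine .graft U W (fun C => (F.restrict {W}ᶜ).restrict {p | p ⊆ C}) F hU hne hWU
      (fun C hC => ?_) ⟨?_, fun p q => ?_⟩
    · refine ih C.ncard ?_ rfl (he.restrict_component hC) (connected_of_mem_components hC)
      rw [← hn]
      refine Set.ncard_lt_ncard ((subset_of_mem_components hC).trans_ssubset ?_) (Set.toFinite U)
      exact Set.sdiff_ssubset_left_iff.2 (by rwa [Set.inter_eq_self_of_subset_right hWU])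
    · rw [← he.isDisjointUnion.1]
      change _ = insert W (F.nodes \ {W})
      rw [Set.insert_sdiff_singleton, Set.insert_eq_of_mem hW]
    · rw [← he.isDisjointUnion.2]
      change _ ↔ _ ∨ F.le p q ∧ p ≠ W ∧ q ≠ W
      constructor
      · intro hpq
        by_cases hq : q = W
        · exact .inl ⟨(F.mem_of_le hpq).1, hq⟩
        · refine .inr ⟨hpq, ?_, hq⟩
          rintro rfl
          exact hq (F.le_antisymm (hle q (F.mem_of_le hpq).2) hpq)
      · rintro (⟨hp, rfl⟩ | ⟨hpq, -⟩)
        · exact hle p hp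
        · exact hpq

theorem mem_partitioningForests_iff [Finite V] :
    F ∈ partitioningForests g ↔ Nested g Set.univ F := by
  constructor
  · rintro ⟨T, hT, hF⟩
    exact nested_of_isDisjointUnion (fun C hC => (hT C hC).nested) hF
  · intro h
    exact ⟨_, fun C hC => (h.restrict_component hC).isPartitioningTree _ rfl
      (connected_of_mem_components hC), h.isDisjointUnion⟩

/-- Adjacent vertices in incomparable nodes `p`, `q` would make `F_{≤ p} ∪ F_{≤ q}` connected.
Conversely, if adjacency forces comparability, no edge joins the sets below incomparable nodes, so
their union is disconnected, and no edge leaves the set below a root, which makes it maximal. -/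
theorem mem_buildingForests_tubes_iff :
    F ∈ buildingForests (tubes g) ↔ Nested g Set.univ F := by
  constructor
  · rintro ⟨hs, -, hc, hA⟩
    refine ⟨hs, hc, fun p hp q hq u hu v hv e => ?_⟩
    by_contra hpq
    rw [not_or] at hpq
    have hne : p ≠ q := by
      rintro rfl
      exact hpq.1 (F.le_refl p hp)
    refine hA {p, q} (Set.pair_subset hp hq) (Set.nontrivial_pair hne) ?_ ?_
    · rintro a (rfl | rfl) b (rfl | rfl) hab
      · exact absurd rfl hab
      · exact hpq.1
      · exact hpq.2
      · exact absurd rfl hab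
    · rw [Set.biUnion_pair]
      have h1 := SimpleGraph.induce_union_connected (hc p hp).preconnected
        (SimpleGraph.induce_pair_connected_of_adj e).preconnected
        ⟨u, subset_below hp hu, Set.mem_insert _ _⟩
      have h2 := SimpleGraph.induce_union_connected h1.preconnected (hc q hq).preconnected
        ⟨v, .inr (Set.mem_insert_of_mem _ rfl), subset_below hq hv⟩
      -- The edge `u v` serves as a connected bridge meeting both sets, and adds no vertices to
      -- their union.
      have h3 : (F.below p ∪ {u, v}) ∪ F.below q = F.below p ∪ F.below q := by
        rw [Set.union_assoc]
        refine Set.Subset.antisymm (Set.union_subset Set.subset_union_left (Set.union_subset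
          (Set.pair_subset (.inl (subset_below hp hu)) (.inr (subset_below hq hv)))
          Set.subset_union_right)) ?_
        exact Set.union_subset_union_right _ Set.subset_union_right
      rw [h3] at h2
      exact h2
  · intro h
    refine ⟨h.support, fun r hr => ⟨h.connected r hr.1, fun I hI hrI => ?_⟩, h.connected,
      fun A hAF hA hpw hcon => ?_⟩
    · obtain ⟨x, hx⟩ := F.nonempty r hr.1
      have hx := subset_below hr.1 hx
      exact h.subset_below_of_isRoot hr hI.preconnected (Set.subset_univ _) (hrI hx) hx
    · obtain ⟨p, hp, q, hq, hpq⟩ := hA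
      obtain ⟨x, hx⟩ := F.nonempty p (hAF hp)
      obtain ⟨y, hy⟩ := F.nonempty q (hAF hq)
      -- If the union were connected it would lie entirely below `p`, putting the other node `q`
      -- below `p`.
      have hsub : (⋃ p ∈ A, F.below p) ⊆ F.below p := by
        refine subset_of_preconnected hcon.preconnected (x := x)
          (Set.mem_biUnion hp (subset_below (hAF hp) hx)) (subset_below (hAF hp) hx)
          fun u hu v hv e => ?_
        simp only [Set.mem_iUnion, exists_prop] at hv
        obtain ⟨r, hr, s, hs, hvs⟩ := hv
        by_cases hrp : r = p
        · exact hrp ▸ ⟨s, hs, hvs⟩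
        · exfalso
          rcases h.le_or_le_of_adj (F.mem_of_le hs).1 hu hvs e with h1 | h1
          · exact (F.le_chain h1 hs).elim (hpw hp hr (Ne.symm hrp)) (hpw hr hp hrp)
          · exact hpw hp hr (Ne.symm hrp) (F.le_trans h1 hs)
      exact hpw hq hp hpq.symm (le_of_mem_below (hAF hq) hy
        (hsub (Set.mem_biUnion hq (subset_below (hAF hq) hy))))

theorem partitioningForests_eq_buildingForests [Finite V] (g : SimpleGraph V) :
    partitioningForests g = buildingForests (tubes g) :=
  Set.ext fun _ => mem_partitioningForests_iff.trans mem_buildingForests_tubes_iff.symm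

end Nested

/-! ### The forest of a colouring -/

section Reach

variable {V α : Type*} [LinearOrder α] (g : SimpleGraph V) (c : V → α)

/-- The vertices that can be reached from `v` through vertices of colour at most that of `v`. -/
def reach (v : V) : Set V := {u | (restrictTo g {w | c w ≤ c v}).Reachable v u}

/-- The vertices of `reach g c v` of the same colour as `v`. -/
def colorClass (v : V) : Set V := {u | u ∈ reach g c v ∧ c u = c v}

variable {g c} {u v w : V}

theorem mem_reach_self : v ∈ reach g c v := SimpleGraph.Reachable.refl v

theorem reach_subset_of_closed {A : Set V} (hv : v ∈ A)
    (h : ∀ u ∈ A, c u ≤ c v → ∀ w, c w ≤ c v → g.Adj u w → w ∈ A) : reach g c v ⊆ A := by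
  rintro u ⟨p⟩
  have : ∀ (a b : V) (_ : (restrictTo g {w | c w ≤ c v}).Walk a b), a ∈ A → b ∈ A := by
    intro a b p
    induction p with
    | nil => exact id
    | cons e _ ih => exact fun ha => ih (h _ ha e.1 _ e.2.1 e.2.2)
  exact this _ _ p hv

theorem le_of_mem_reach (h : u ∈ reach g c v) : c u ≤ c v :=
  reach_subset_of_closed (A := {u | c u ≤ c v}) (Set.mem_ofPred.2 le_rfl)
    (fun _ _ _ _ hw _ => hw) h

theorem mem_reach_of_adj (h : u ∈ reach g c v) (hw : c w ≤ c v) (e : g.Adj u w) :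
    w ∈ reach g c v := by
  have e' : (restrictTo g {w | c w ≤ c v}).Adj u w := ⟨le_of_mem_reach h, hw, e⟩
  exact SimpleGraph.Reachable.trans h e'.reachable

theorem reach_subset (h : u ∈ reach g c v) : reach g c u ⊆ reach g c v :=
  reach_subset_of_closed h fun _ ha _ _ hw e =>
    mem_reach_of_adj ha (hw.trans (le_of_mem_reach h)) e

/-- Both reachabilities hold at the larger threshold `c v`. Thus reaches that meet are nested, which
gives the chain condition of `colorForest`. -/
theorem mem_reach_of_common (h : w ∈ reach g c u) (h' : w ∈ reach g c v) (hc : c u ≤ c v) :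
    u ∈ reach g c v := by
  have hle : restrictTo g {w | c w ≤ c u} ≤ restrictTo g {w | c w ≤ c v} :=
    fun a b e => ⟨e.1.trans hc, e.2.1.trans hc, e.2.2⟩
  exact SimpleGraph.Reachable.trans h' (SimpleGraph.Reachable.mono hle h).symm

theorem connected_reach (g : SimpleGraph V) (c : V → α) (v : V) :
    (g.induce (reach g c v)).Connected := by
  rw [SimpleGraph.connected_iff_exists_forall_reachable]
  refine ⟨⟨v, mem_reach_self⟩, ?_⟩
  rintro ⟨u, hu⟩
  have := reach_subset_of_closed (g := g) (c := c) (v := v)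
    (A := {u | ∃ hu : u ∈ reach g c v, (g.induce (reach g c v)).Reachable ⟨v, mem_reach_self⟩ ⟨u, hu⟩})
    ⟨mem_reach_self, .refl _⟩ (by
      rintro a ⟨ha, hr⟩ - b hb e
      have hb' := mem_reach_of_adj ha hb e
      have e' : (g.induce (reach g c v)).Adj ⟨a, ha⟩ ⟨b, hb'⟩ := e
      exact ⟨hb', hr.trans e'.reachable⟩) hu
  exact this.2

theorem mem_colorClass_self : v ∈ colorClass g c v := ⟨mem_reach_self, rfl⟩

theorem reach_eq (h : u ∈ colorClass g c v) : reach g c u = reach g c v := by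
  refine (reach_subset h.1).antisymm (reach_subset ?_)
  have := SimpleGraph.Reachable.symm h.1
  rwa [← h.2] at this

theorem colorClass_eq (h : u ∈ colorClass g c v) : colorClass g c u = colorClass g c v := by
  ext w
  rw [colorClass, colorClass, reach_eq h, h.2]

variable (g c) in
/-- The forest whose nodes are the sets `colorClass g c v`. -/
def colorForest : LabelledForest V where
  nodes := Set.range (colorClass g c)
  nonempty := by
    rintro _ ⟨v, rfl⟩
    exact ⟨v, mem_colorClass_self⟩
  disjoint := by
    rintro _ ⟨u, rfl⟩ _ ⟨v, rfl⟩ h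
    refine Set.disjoint_left.2 fun w hw hw' => h ?_
    rw [← colorClass_eq hw, ← colorClass_eq hw']
  -- A node does not remember a vertex, so representatives are quantified; the choice is immaterial
  -- because `reach` is constant on a class.
  le p q := ∃ u v, p = colorClass g c u ∧ q = colorClass g c v ∧ reach g c u ⊆ reach g c v
  mem_of_le := by
    rintro p q ⟨u, v, rfl, rfl, -⟩
    exact ⟨⟨u, rfl⟩, ⟨v, rfl⟩⟩
  le_refl := by
    rintro _ ⟨v, rfl⟩
    exact ⟨v, v, rfl, rfl, le_rfl⟩
  le_antisymm := by
    rintro p q ⟨u, v, rfl, rfl, h⟩ ⟨v', u', hv, hu, h'⟩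
    have hv : v ∈ colorClass g c v' := hv ▸ mem_colorClass_self
    have hu : u ∈ colorClass g c u' := hu ▸ mem_colorClass_self
    rw [← reach_eq hv, ← reach_eq hu] at h'
    have h1 := h mem_reach_self
    exact colorClass_eq ⟨h1, (le_of_mem_reach h1).antisymm (le_of_mem_reach (h' mem_reach_self))⟩
  le_trans := by
    rintro p q r ⟨u, v, rfl, rfl, h⟩ ⟨v', w, hv, rfl, h'⟩
    have hv : v ∈ colorClass g c v' := hv ▸ mem_colorClass_self
    rw [← reach_eq hv] at h'
    exact ⟨u, w, rfl, rfl, h.trans h'⟩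
  le_chain := by
    rintro p q r ⟨u, v, rfl, rfl, h⟩ ⟨u', w, hu, rfl, h'⟩
    have hu : u ∈ colorClass g c u' := hu ▸ mem_colorClass_self
    rw [← reach_eq hu] at h'
    have hv := h mem_reach_self
    have hw := h' mem_reach_self
    exact (le_total (c v) (c w)).imp
      (fun k => ⟨v, w, rfl, rfl, reach_subset (mem_reach_of_common hv hw k)⟩)
      fun k => ⟨w, v, rfl, rfl, reach_subset (mem_reach_of_common hw hv k)⟩

theorem colorForest_le_iff :
    (colorForest g c).le (colorClass g c u) (colorClass g c v) ↔ u ∈ reach g c v := by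
  constructor
  · rintro ⟨u', v', hu, hv, h⟩
    have hv : v ∈ colorClass g c v' := hv ▸ mem_colorClass_self
    have hu : u ∈ colorClass g c u' := hu ▸ mem_colorClass_self
    rw [← reach_eq hv, ← reach_eq hu] at h
    exact h mem_reach_self
  · exact fun h => ⟨u, v, rfl, rfl, reach_subset h⟩

theorem below_colorForest : (colorForest g c).below (colorClass g c v) = reach g c v := by
  ext u
  constructor
  · rintro ⟨p, hp, hu⟩
    obtain ⟨w, rfl⟩ := ((colorForest g c).mem_of_le hp).1
    exact reach_subset (colorForest_le_iff.1 hp) hu.1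
  · exact fun h => ⟨_, colorForest_le_iff.2 h, mem_colorClass_self⟩

/-- Of two adjacent vertices, the one of smaller or equal colour is in the reach of the other,
whence comparability. -/
theorem nested_colorForest (g : SimpleGraph V) (c : V → α) :
    Nested g Set.univ (colorForest g c) where
  support := Set.eq_univ_of_forall fun v => ⟨_, ⟨v, rfl⟩, mem_colorClass_self⟩
  connected := by
    rintro _ ⟨v, rfl⟩
    rw [below_colorForest]
    exact connected_reach g c v
  comparable := by
    rintro _ ⟨u', rfl⟩ _ ⟨v', rfl⟩ u hu v hv e
    rw [← colorClass_eq hu, ← colorClass_eq hv, colorForest_le_iff, colorForest_le_iff]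
    exact (le_total (c u) (c v)).imp (fun h => mem_reach_of_adj mem_reach_self h e.symm)
      fun h => mem_reach_of_adj mem_reach_self h e

/-- Strict compatibility for colourings with values in any linear order. -/
def LabelledForest.IsStrict (F : LabelledForest V) (c : V → α) : Prop :=
  (∀ p ∈ F.nodes, ∀ v ∈ p, ∀ v' ∈ p, c v = c v') ∧
    ∀ p q, F.le p q → p ≠ q → ∀ v ∈ p, ∀ v' ∈ q, c v < c v'

theorem isStrict_colorForest (g : SimpleGraph V) (c : V → α) : (colorForest g c).IsStrict c := by
  constructor
  · rintro _ ⟨w, rfl⟩ u hu v hv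
    rw [hu.2, hv.2]
  · rintro p q h hne
    obtain ⟨⟨u, rfl⟩, v, rfl⟩ := (colorForest g c).mem_of_le h
    rw [colorForest_le_iff] at h
    intro x hx y hy
    rw [hx.2, hy.2]
    exact (le_of_mem_reach h).lt_of_ne fun e => hne (colorClass_eq ⟨h, e⟩)

variable {F : LabelledForest V} {p : Set V}

theorem LabelledForest.IsStrict.le_of_mem_below (hc : F.IsStrict c) (hv : v ∈ p)
    (hu : u ∈ F.below p) : c u ≤ c v := by
  obtain ⟨q, hq, hu⟩ := hu
  by_cases h : q = p
  · subst h
    exact (hc.1 q (F.mem_of_le hq).1 u hu v hv).le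
  · exact (hc.2 q p hq h u hu v hv).le

theorem LabelledForest.IsStrict.mem_of_mem_below (hc : F.IsStrict c) (hv : v ∈ p)
    (hu : u ∈ F.below p) (h : c u = c v) : u ∈ p := by
  obtain ⟨q, hq, hu⟩ := hu
  by_cases hqp : q = p
  · exact hqp ▸ hu
  · exact absurd h (hc.2 q p hq hqp u hu v hv).ne

/-- `F_{≤ p}` is connected with colours at most `c v`, so it lies in the reach. An edge leaving it
ends in a proper ancestor of `p`, whose colour exceeds `c v`, so the reach cannot escape. -/
theorem Nested.below_eq_reach (h : Nested g Set.univ F) (hc : F.IsStrict c) (hp : p ∈ F.nodes)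
    (hv : v ∈ p) : F.below p = reach g c v := by
  apply Set.Subset.antisymm
  · exact subset_of_preconnected (h.connected p hp).preconnected (subset_below hp hv)
      mem_reach_self fun u hu w hw e => mem_reach_of_adj hu (hc.le_of_mem_below hv hw) e
  · refine reach_subset_of_closed (subset_below hp hv) fun u hu _ w hw e => ?_
    obtain ⟨q, hq, hwq⟩ := h.exists_node (Set.mem_univ w)
    rcases h.le_or_le_of_adj hq hu hwq e with h1 | h1
    · exact ⟨q, h1, hwq⟩
    · by_cases hpq : p = q
      · exact ⟨q, hpq ▸ F.le_refl q hq, hwq⟩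
      · exact absurd (hc.2 p q h1 hpq v hv w hwq) (not_lt_of_ge hw)

theorem Nested.node_eq_colorClass (h : Nested g Set.univ F) (hc : F.IsStrict c)
    (hp : p ∈ F.nodes) (hv : v ∈ p) : p = colorClass g c v := by
  ext u
  rw [colorClass, ← h.below_eq_reach hc hp hv]
  exact ⟨fun hu => ⟨subset_below hp hu, hc.1 p hp u hu v hv⟩,
    fun hu => hc.mem_of_mem_below hv hu.1 hu.2⟩

/-- Uniqueness of the forest: a strictly compatible colouring determines each `F_{≤ p}` as a reach,
hence the nodes (the vertices of top colour there) and their order. -/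
theorem Nested.eq_colorForest (h : Nested g Set.univ F) (hc : F.IsStrict c) :
    F = colorForest g c := by
  have hn : ∀ v, colorClass g c v ∈ F.nodes := by
    intro v
    obtain ⟨p, hp, hv⟩ := h.exists_node (Set.mem_univ v)
    rwa [← h.node_eq_colorClass hc hp hv]
  have hn' : ∀ p ∈ F.nodes, ∃ v, p = colorClass g c v := by
    intro p hp
    obtain ⟨v, hv⟩ := F.nonempty p hp
    exact ⟨v, h.node_eq_colorClass hc hp hv⟩
  have hle : ∀ u v, F.le (colorClass g c u) (colorClass g c v) ↔ u ∈ reach g c v := by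
    intro u v
    rw [← h.below_eq_reach hc (hn v) mem_colorClass_self]
    exact ⟨fun k => ⟨_, k, mem_colorClass_self⟩,
      fun k => LabelledForest.le_of_mem_below (hn u) mem_colorClass_self k⟩
  refine LabelledForest.ext ?_ (funext fun p => funext fun q => propext ?_)
  · ext p
    constructor
    · intro hp
      obtain ⟨v, rfl⟩ := hn' p hp
      exact ⟨v, rfl⟩
    · rintro ⟨v, rfl⟩
      exact hn v
  · constructor
    · intro hpq
      obtain ⟨u, rfl⟩ := hn' p (F.mem_of_le hpq).1
      obtain ⟨v, rfl⟩ := hn' q (F.mem_of_le hpq).2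
      exact colorForest_le_iff.2 ((hle u v).1 hpq)
    · intro hpq
      obtain ⟨⟨u, rfl⟩, v, rfl⟩ := (colorForest g c).mem_of_le hpq
      exact (hle u v).2 (colorForest_le_iff.1 hpq)

/-! ### The graph of a colouring -/

variable (g c) in
/-- The disjoint union over the colours `i` of the graphs induced by `i` in `g` sewn through the
smaller colours. -/
def colorGraph : SimpleGraph V where
  Adj u v := c u = c v ∧ (sew g {w | c w < c u}).Adj u v
  symm := ⟨by
    rintro u v ⟨h, e⟩
    rw [h] at e
    exact ⟨h.symm, e.symm⟩⟩
  loopless := ⟨fun _ h => h.2.ne rfl⟩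

/-- A walk starting in `R` with inner vertices in `S` has all of them in `R` when no edge leads from
`R` to a vertex of `S` outside `R`. -/
theorem Thru.inter {S R : Set V} (h : ∀ a ∈ R, ∀ b ∈ S, g.Adj a b → b ∈ R) {a b : V}
    (t : Thru g S a b) (ha : a ∈ R) : Thru g (S ∩ R) a b := by
  induction t with
  | adj e => exact .adj e
  | step e hb _ ih => exact .step e ⟨hb, h _ ha _ hb e⟩ (ih (h _ ha _ hb e))

theorem mem_reach_of_thru {a b : V} (t : Thru g {w | c w < c v} a b) (ha : a ∈ reach g c v)
    (hb : c b ≤ c v) : b ∈ reach g c v := by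
  induction t with
  | adj e => exact mem_reach_of_adj ha hb e
  | step e hS _ ih => exact ih (mem_reach_of_adj ha (le_of_lt hS) e) hb

theorem mem_colorClass_of_adj (h : (colorGraph g c).Adj u v) : v ∈ colorClass g c u :=
  ⟨mem_reach_of_thru (sew_adj.1 h.2).2.2.2 mem_reach_self h.1.ge, h.1.symm⟩

theorem mem_colorClass_of_reachable (h : (colorGraph g c).Reachable u v) :
    v ∈ colorClass g c u := by
  obtain ⟨p⟩ := h
  induction p with
  | nil => exact mem_colorClass_self
  | cons e _ ih => rwa [colorClass_eq (mem_colorClass_of_adj e)] at ih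

theorem colorGraph_adj_of_thru {x y : V} (hx : c x = c u) (hy : c y = c u)
    (t : Thru g {w | c w < c u} x y) : x = y ∨ (colorGraph g c).Adj x y := by
  by_cases hxy : x = y
  · exact .inl hxy
  · refine .inr ⟨hx.trans hy.symm, sew_adj.2 ⟨hxy, ?_, ?_, ?_⟩⟩
    · simp
    · simp [hx, hy]
    · rwa [hx]

theorem reachable_of_mem_colorClass (h : v ∈ colorClass g c u) :
    (colorGraph g c).Reachable u v := by
  -- Along a walk from `u`, the witness `x` is the last vertex met of colour `c u`; everything since
  -- then has smaller colour. Consecutive such vertices are equal or adjacent in `colorGraph`.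
  have key := reach_subset_of_closed (g := g) (c := c) (v := u)
    (A := {w | ∃ x, c x = c u ∧ (colorGraph g c).Reachable u x ∧
      (x = w ∨ (c w < c u ∧ Thru g {w | c w < c u} x w))}) ⟨u, rfl, .refl _, .inl rfl⟩ (by
    rintro a ⟨x, hx, hr, ha⟩ - b hb e
    have t : Thru g {w | c w < c u} x b := by
      rcases ha with rfl | ⟨ha, t⟩
      · exact .adj e
      · exact t.trans ha (.adj e)
    rcases hb.lt_or_eq with hb | hb
    · exact ⟨x, hx, hr, .inr ⟨hb, t⟩⟩
    · refine ⟨b, hb, ?_, .inl rfl⟩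
      rcases colorGraph_adj_of_thru hx hb t with rfl | e'
      · exact hr
      · exact hr.trans e'.reachable) h.1
  obtain ⟨x, -, hr, rfl | ⟨hlt, -⟩⟩ := key
  · exact hr
  · exact absurd h.2 hlt.ne

/-- Reachability in `colorGraph` is membership in the same colour class, so a component amounts to a
node. -/
theorem cc_colorGraph (g : SimpleGraph V) (c : V → α) :
    cc (colorGraph g c) = Nat.card (colorForest g c).Node := by
  refine Nat.card_congr (Equiv.ofBijective
    (SimpleGraph.ConnectedComponent.lift (fun v => ⟨colorClass g c v, v, rfl⟩) ?_) ⟨?_, ?_⟩)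
  · intro u v p _
    exact Subtype.ext (colorClass_eq (mem_colorClass_of_reachable p.reachable)).symm
  · intro k l
    induction k using SimpleGraph.ConnectedComponent.ind with | _ u
    induction l using SimpleGraph.ConnectedComponent.ind with | _ v
    intro h
    have h' : colorClass g c u = colorClass g c v := congrArg Subtype.val h
    refine SimpleGraph.ConnectedComponent.eq.2 (reachable_of_mem_colorClass ?_)
    rw [h']
    exact mem_colorClass_self
  · rintro ⟨_, v, rfl⟩
    exact ⟨(colorGraph g c).connectedComponentMk v, rfl⟩

/-- A path from `p` through smaller colours stays in `F_{≤ p}`, where having a smaller colour means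
lying outside `p`, for `c` and `c'` alike. The hypotheses are symmetric in `c` and `c'`, so the two
graphs coincide. -/
theorem Nested.colorGraph_le {β : Type*} [LinearOrder β] {c' : V → β}
    (h : Nested g Set.univ F) (hc : F.IsStrict c) (hc' : F.IsStrict c') :
    colorGraph g c ≤ colorGraph g c' := by
  intro u v e
  obtain ⟨p, hp, hu⟩ := h.exists_node (Set.mem_univ u)
  have hb := h.below_eq_reach hc hp hu
  have hv : v ∈ p := by
    rw [h.node_eq_colorClass hc hp hu]
    exact mem_colorClass_of_adj e
  have huv := hc'.1 p hp u hu v hv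
  refine ⟨huv, sew_adj.2 ⟨e.ne, by simp, by simp [huv], ?_⟩⟩
  refine Thru.mono ?_ (Thru.inter (R := F.below p) ?_ (sew_adj.1 e.2).2.2.2 (subset_below hp hu))
  · rintro w ⟨hw, hwp⟩
    exact (hc'.le_of_mem_below hu hwp).lt_of_ne fun k =>
      (Set.mem_ofPred.1 hw).ne (hc.1 p hp w (hc'.mem_of_mem_below hu hwp k) u hu)
  · intro a ha b hb' e
    rw [hb] at ha ⊢
    exact mem_reach_of_adj ha (le_of_lt hb') e

end Reach

/-! ### Identification of the ripped and sewn graph with the graph of a colouring. -/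

section RipSewRounds

variable {V : Type*} [Finite V]

theorem LabelledForest.leaves_nonempty (F : LabelledForest V) (h : F.nodes.Nonempty) :
    F.leaves.Nonempty := by
  obtain ⟨p, hp⟩ := h
  obtain ⟨q, -, hq⟩ := (Set.finite_univ (α := F.Node)).exists_minimal ⟨⟨p, hp⟩, trivial⟩
  refine ⟨q.1, q.2, fun r hr => F.le_antisymm hr ?_⟩
  exact hq (y := ⟨r, (F.mem_of_le hr).1⟩) trivial hr

/-- The rounds of ripping and sewing produce the graph of a strictly compatible colouring. -/
theorem exists_coloring_ripSewRounds (k : ℕ) : ∀ (g : SimpleGraph V) (F : LabelledForest V),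
    F.nodes.ncard ≤ k → ∃ c : V → ℕ, F.IsStrict c ∧ ∀ u v, (ripSewRounds k g F).Adj u v ↔
      (∃ p ∈ F.nodes, u ∈ p ∧ v ∈ p) ∧ (sew g {w | w ∈ F.support ∧ c w < c u}).Adj u v := by
  induction k with
  | zero =>
    intro g F hF
    have h0 : F.nodes = ∅ := by
      rwa [Nat.le_zero, Set.ncard_eq_zero (Set.toFinite _)] at hF
    refine ⟨fun _ => 0, ⟨fun p hp => ?_, fun p q hpq => ?_⟩, fun u v => ?_⟩
    · simp [h0] at hp
    · have := (F.mem_of_le hpq).1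
      simp [h0] at this
    · simp [ripSewRounds, h0]
  | succ k ih =>
    intro g F hF
    classical
    have hF' : F.deleteLeaves.nodes.ncard ≤ k := by
      rcases F.nodes.eq_empty_or_nonempty with h0 | h0
      · change (F.nodes \ F.leaves).ncard ≤ k
        simp [h0]
      · refine Nat.le_of_lt_succ (lt_of_lt_of_le (Set.ncard_lt_ncard ?_ (Set.toFinite _)) hF)
        refine Set.sdiff_ssubset_left_iff.2 ?_
        obtain ⟨q, hq⟩ := F.leaves_nonempty h0
        exact ⟨q, hq.1, hq⟩
    obtain ⟨c, hc, hadj⟩ := ih (sew g (⋃₀ F.leaves)) F.deleteLeaves hF'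
    have hleaf : ∀ {p v}, p ∈ F.nodes → v ∈ p → (v ∈ ⋃₀ F.leaves ↔ p ∈ F.leaves) := by
      intro p v hp hv
      constructor
      · rintro ⟨q, hq, hvq⟩
        rwa [node_eq hp hq.1 hv hvq]
      · exact fun h => ⟨p, h, hv⟩
    have hnl : ∀ {p q}, F.le p q → p ≠ q → q ∉ F.leaves := fun hpq hne hq => hne (hq.2 _ hpq)
    -- On the support of `F`, the colour is the number of the round that deletes the node: leaves
    -- get `0`, and the colouring of the remaining forest is shifted by one.
    let d : V → ℕ := fun v => if v ∈ ⋃₀ F.leaves then 0 else c v + 1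
    have hd0 : ∀ {v}, v ∈ ⋃₀ F.leaves → d v = 0 := fun hv => if_pos hv
    have hd1 : ∀ {v}, v ∉ ⋃₀ F.leaves → d v = c v + 1 := fun hv => if_neg hv
    -- After `sew_sew` merges the sewing of this round with that of the later ones, the set sewn
    -- through is exactly the set of vertices of smaller `d`-colour.
    have hset : ∀ {u}, u ∉ ⋃₀ F.leaves →
        ⋃₀ F.leaves ∪ {w | w ∈ F.deleteLeaves.support ∧ c w < c u} =
          {w | w ∈ F.support ∧ d w < d u} := by
      intro u hu
      ext w
      rw [Set.mem_union, Set.mem_ofPred, Set.mem_ofPred, hd1 hu]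
      constructor
      · rintro (hw | ⟨⟨p, hp, hwp⟩, hlt⟩)
        · refine ⟨?_, by rw [hd0 hw]; omega⟩
          obtain ⟨p, hp, hwp⟩ := hw
          exact ⟨p, hp.1, hwp⟩
        · refine ⟨⟨p, hp.1, hwp⟩, ?_⟩
          rw [hd1 ((hleaf hp.1 hwp).not.2 hp.2)]
          omega
      · rintro ⟨⟨p, hp, hwp⟩, hlt⟩
        by_cases hpl : p ∈ F.leaves
        · exact .inl ⟨p, hpl, hwp⟩
        · rw [hd1 ((hleaf hp hwp).not.2 hpl)] at hlt
          exact .inr ⟨⟨p, ⟨hp, hpl⟩, hwp⟩, by omega⟩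
    refine ⟨d, ⟨fun p hp v hv v' hv' => ?_, fun p q hpq hne v hv v' hv' => ?_⟩, fun u v => ?_⟩
    · by_cases hpl : p ∈ F.leaves
      · rw [hd0 ⟨p, hpl, hv⟩, hd0 ⟨p, hpl, hv'⟩]
      · rw [hd1 ((hleaf hp hv).not.2 hpl), hd1 ((hleaf hp hv').not.2 hpl),
          hc.1 p ⟨hp, hpl⟩ v hv v' hv']
    · obtain ⟨hp, hq⟩ := F.mem_of_le hpq
      have hql := hnl hpq hne
      rw [hd1 ((hleaf hq hv').not.2 hql)]
      by_cases hpl : p ∈ F.leaves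
      · rw [hd0 ⟨p, hpl, hv⟩]
        omega
      · rw [hd1 ((hleaf hp hv).not.2 hpl)]
        have := hc.2 p q ⟨hpq, hpl, hql⟩ hne v hv v' hv'
        omega
    · rw [ripSewRounds, SimpleGraph.sup_adj, hadj, sew_sew]
      simp only [SimpleGraph.iSup_adj]
      constructor
      · rintro (⟨p, hp, hu, hv, e⟩ | ⟨⟨p, hp, hu, hv⟩, e⟩)
        · refine ⟨⟨p, hp.1, hu, hv⟩, ?_⟩
          rwa [sew_empty]
          rw [hd0 ⟨p, hp, hu⟩]
          simp
        · rw [hset ((hleaf hp.1 hu).not.2 hp.2)] at e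
          exact ⟨⟨p, hp.1, hu, hv⟩, e⟩
      · rintro ⟨⟨p, hp, hu, hv⟩, e⟩
        by_cases hpl : p ∈ F.leaves
        · rw [sew_empty] at e
          · exact .inl ⟨p, hpl, hu, hv, e⟩
          · rw [hd0 ⟨p, hpl, hu⟩]
            simp
        · rw [hset ((hleaf hp hu).not.2 hpl)]
          exact .inr ⟨⟨p, ⟨hp, hpl⟩, hu, hv⟩, e⟩

/-- Choosing a vertex in each node is injective by disjointness; so `Nat.card V` rounds exhaust the
forest. -/
theorem LabelledForest.ncard_nodes_le (F : LabelledForest V) : F.nodes.ncard ≤ Nat.card V := by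
  rw [← Nat.card_coe_set_eq]
  refine Nat.card_le_card_of_injective (fun p : F.nodes => (F.nonempty p.1 p.2).some) fun p q h => ?_
  have hp := (F.nonempty p.1 p.2).some_mem
  have hq := (F.nonempty q.1 q.2).some_mem
  exact Subtype.ext (node_eq p.2 q.2 hp (by rw [show (F.nonempty p.1 p.2).some = _ from h]; exact hq))

variable {g : SimpleGraph V} {F : LabelledForest V}

theorem Nested.exists_ripSew_eq (h : Nested g Set.univ F) :
    ∃ c : V → ℕ, F.IsStrict c ∧ ripSew g F = colorGraph g c := by
  obtain ⟨c, hc, hadj⟩ := exists_coloring_ripSewRounds _ g F F.ncard_nodes_le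
  refine ⟨c, hc, ?_⟩
  ext u v
  rw [ripSew, hadj, h.support]
  simp only [Set.mem_univ, true_and]
  constructor
  · rintro ⟨⟨p, hp, hu, hv⟩, e⟩
    exact ⟨hc.1 p hp u hu v hv, e⟩
  · intro e
    obtain ⟨p, hp, hu⟩ := h.exists_node (Set.mem_univ u)
    refine ⟨⟨p, hp, hu, ?_⟩, e.2⟩
    rw [h.node_eq_colorClass hc hp hu]
    exact mem_colorClass_of_adj e

theorem Nested.ripSew_eq {α : Type*} [LinearOrder α] {c : V → α} (h : Nested g Set.univ F)
    (hc : F.IsStrict c) : ripSew g F = colorGraph g c := by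
  obtain ⟨d, hd, e⟩ := h.exists_ripSew_eq
  rw [e]
  exact (h.colorGraph_le hd hc).antisymm (h.colorGraph_le hc hd)

theorem Nested.cc_ripSew (h : Nested g Set.univ F) : cc (ripSew g F) = Nat.card F.Node := by
  obtain ⟨c, hc, e⟩ := h.exists_ripSew_eq
  rw [e, cc_colorGraph, ← h.eq_colorForest hc]

end RipSewRounds

/-! ### The polynomial invariant as a sum over colourings -/

theorem sewPart_comap_sumCompl {V : Type*} (g : SimpleGraph V) (p : V → Prop) [DecidablePred p] :
    sewPart (g.comap (Equiv.sumCompl p)) =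
      (sew g {v | p v}).comap (Subtype.val : {v // ¬ p v} → V) := by
  have h := sew_comap g {v | p v} (Equiv.sumCompl p) (Equiv.injective _) (by
    rw [(Equiv.surjective _).range_eq]
    exact Set.subset_univ _)
  have e : Equiv.sumCompl p ⁻¹' {v | p v} = Set.range Sum.inl := by
    ext (a | a)
    · simpa using a.2
    · simpa using a.2
  rw [e] at h
  rw [sewPart, ← h]
  rfl

section GraphVector

variable (K : Type w) [Field K]

/-- The basis vector of the species of graphs given by a graph. -/
def graphVector {V : Type u} [Finite V] (g : SimpleGraph V) : (graphHopf.{u} K).obj V :=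
  (Finsupp.single g 1 : SimpleGraph V →₀ K)

theorem map_graphVector {V W : Type u} [Finite V] [Finite W] (σ : V ≃ W) (g : SimpleGraph V) :
    (graphHopf.{u} K).map σ (graphVector K g) = graphVector K (g.comap σ.symm) :=
  sgMap_single K σ g 1

theorem mul_graphVector {V W : Type u} [Finite V] [Finite W] (g : SimpleGraph V)
    (h : SimpleGraph W) :
    (graphHopf.{u} K).mul V W (graphVector K g ⊗ₜ[K] graphVector K h) = graphVector K (g ⊕g h) :=
  (sgMul_single K g h 1 1).trans (by rw [mul_one]; rfl)

theorem comul_graphVector {V W : Type u} [Finite V] [Finite W] (g : SimpleGraph (V ⊕ W)) :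
    (graphHopf.{u} K).comul V W (graphVector K g) =
      graphVector K (ripPart g) ⊗ₜ[K] graphVector K (sewPart g) :=
  sgComul_single K g

end GraphVector

/-- Induction on the number of colours. The coproduct splits off the graph induced by colour `0` and
sews the rest through it; sewing on through the positive colours below that of `a` amounts to sewing
`g` through all colours below it. -/
theorem mulComul_graphVector {K : Type w} [Field K] (n : ℕ) : ∀ (V : Type u) [Finite V]
    (c : V → Fin n) (g : SimpleGraph V),
    mulComul (graphHopf.{u} K) n V c (graphVector K g) = graphVector K (colorGraph g c) := by
  induction n with
  | zero =>
    intro V _ c g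
    have : IsEmpty V := ⟨fun v => (c v).elim0⟩
    rw [Subsingleton.elim (colorGraph g c) g]
    rfl
  | succ n ih =>
    intro V _ c g
    let e := Equiv.sumCompl fun v : V => c v = 0
    let c' : {v : V // ¬ c v = 0} → Fin n := fun v => (c v.1).pred v.2
    have h : mulComul (graphHopf.{u} K) (n + 1) V c (graphVector K g) =
        (graphHopf.{u} K).map e ((graphHopf.{u} K).mul _ _ (TensorProduct.map LinearMap.id
          (mulComul (graphHopf.{u} K) n _ c') ((graphHopf.{u} K).comul _ _
            ((graphHopf.{u} K).map e.symm (graphVector K g))))) := rfl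
    rw [h, map_graphVector, comul_graphVector, TensorProduct.map_tmul, ih, LinearMap.id_apply,
      mul_graphVector, map_graphVector]
    congr 1
    rw [Equiv.symm_symm, sewPart_comap_sumCompl]
    have key : ∀ a b : {v : V // c v = 0} ⊕ {v : V // ¬ c v = 0},
        (ripPart (g.comap e) ⊕g colorGraph ((sew g {v | c v = 0}).comap Subtype.val) c').Adj a b ↔
          (colorGraph g c).Adj (e a) (e b) := by
      rintro (a | a) (b | b)
      · have h0 : {w | c w < c a.1} = ∅ := by
          ext w
          simp [a.2]
        simp only [SimpleGraph.sum_adj]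
        change g.Adj a.1 b.1 ↔ c a.1 = c b.1 ∧ (sew g {w | c w < c a.1}).Adj a.1 b.1
        rw [sew_empty g h0, a.2, b.2]
        simp
      · simp only [SimpleGraph.sum_adj, false_iff]
        exact fun h => b.2 (h.1.symm.trans a.2)
      · simp only [SimpleGraph.sum_adj, false_iff]
        exact fun h => a.2 (h.1.trans b.2)
      · simp only [SimpleGraph.sum_adj]
        change c' a = c' b ∧ (sew ((sew g {v | c v = 0}).comap Subtype.val) {w | c' w < c' a}).Adj a b
          ↔ c a.1 = c b.1 ∧ (sew g {w | c w < c a.1}).Adj a.1 b.1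
        have h1 := sew_comap (sew g {v | c v = 0}) {w | c w ≠ 0 ∧ c w < c a.1}
          (Subtype.val : {v : V // ¬ c v = 0} → V) Subtype.val_injective (by
            rintro w ⟨hw, -⟩
            exact ⟨⟨w, hw⟩, rfl⟩)
        have h2 : (Subtype.val : {v : V // ¬ c v = 0} → V) ⁻¹' {w | c w ≠ 0 ∧ c w < c a.1} =
            {w | c' w < c' a} := by
          ext w
          simp [c', w.2]
        have h3 : {v | c v = 0} ∪ {w | c w ≠ 0 ∧ c w < c a.1} = {w | c w < c a.1} := by
          ext w
          have := Fin.pos_iff_ne_zero.2 a.2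
          by_cases hw : c w = 0
          · simp [hw, this]
          · simp [hw]
        rw [h2, sew_sew, h3] at h1
        rw [← h1]
        simp [c']
    ext a b
    rw [SimpleGraph.comap_adj, key, e.apply_symm_apply, e.apply_symm_apply]

/-! ### Values of characters on graphs, and the sign for odd characters. -/

section Character

variable {K : Type w} [Field K] (ζ : Character (graphHopf.{u} K))

theorem graphChi_eq_sum {V : Type u} [Finite V] (g : SimpleGraph V) (n : ℕ) :
    graphChi ζ g n = ∑ᶠ c : V → Fin n, ζ.onGraph (colorGraph g c) :=
  finsum_congr fun c => congrArg (ζ.toFun V) (mulComul_graphVector n V c g)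

theorem Character.onGraph_comap {V W : Type u} [Finite V] [Finite W] (σ : V ≃ W)
    (g : SimpleGraph V) : ζ.onGraph (g.comap σ.symm) = ζ.onGraph g := by
  have h := ζ.natural σ (graphVector K g)
  rwa [map_graphVector] at h

theorem Character.onGraph_sum {V W : Type u} [Finite V] [Finite W] (g : SimpleGraph V)
    (h : SimpleGraph W) : ζ.onGraph (g ⊕g h) = ζ.onGraph g * ζ.onGraph h := by
  have k := ζ.map_mul V W (graphVector K g) (graphVector K h)
  rwa [mul_graphVector] at k

/-- When no edge crosses between `p` and its complement, the graph is the disjoint union of the two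
induced graphs, so naturality and multiplicativity apply. -/
theorem Character.onGraph_split {V : Type u} [Finite V] (g : SimpleGraph V) (p : V → Prop)
    (hp : ∀ u v, g.Adj u v → (p u ↔ p v)) :
    ζ.onGraph g = ζ.onGraph (g.comap (Subtype.val : {v // p v} → V)) *
      ζ.onGraph (g.comap (Subtype.val : {v // ¬ p v} → V)) := by
  classical
  rw [← ζ.onGraph_sum, ← ζ.onGraph_comap (Equiv.sumCompl p).symm]
  congr 1
  ext (a | a) (b | b)
  · simp
  · simpa using fun h => b.2 ((hp _ _ h).1 a.2)
  · simpa using fun h => a.2 ((hp _ _ h).2 b.2)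
  · simp

/-- Splitting off a component shows that `ζ` is nonzero on each of them, so each has odd size; `|V|`
is a sum of `cc g` odd numbers. -/
theorem Character.neg_one_pow_card {V : Type u} [Finite V] (hζ : ζ.IsOdd) (g : SimpleGraph V)
    (hg : ζ.onGraph g ≠ 0) : (-1 : K) ^ Nat.card V = (-1) ^ cc g := by
  classical
  have hodd : ∀ k : g.ConnectedComponent, Odd (Nat.card {v // g.connectedComponentMk v = k}) := by
    intro k
    refine hζ _ (g.comap Subtype.val) k.connected_toSimpleGraph fun h0 => hg ?_
    rw [ζ.onGraph_split g (fun v => g.connectedComponentMk v = k), h0, zero_mul]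
    intro u v e
    rw [SimpleGraph.ConnectedComponent.connectedComponentMk_eq_of_adj e]
  have := Fintype.ofFinite g.ConnectedComponent
  rw [← Nat.card_congr (Equiv.sigmaFiberEquiv g.connectedComponentMk), Nat.card_sigma,
    ← Finset.prod_pow_eq_pow_sum, Finset.prod_congr rfl fun k _ => (hodd k).neg_one_pow,
    Finset.prod_const, Finset.card_univ, cc, Nat.card_eq_fintype_card]

end Character

/-! ### Counting the compatible colourings of a forest -/

section Count

variable {V : Type*} {F : LabelledForest V}

/-- Colourings of `V` satisfying a relation along a forest correspond to colourings of its nodes. -/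
theorem ncard_forestColorings (h : F.support = Set.univ) (r : ℕ → ℕ → Prop) (n : ℕ) :
    Set.ncard {c : V → Fin n | (∀ p ∈ F.nodes, ∀ v ∈ p, ∀ v' ∈ p, c v = c v') ∧
      ∀ p q, F.le p q → p ≠ q → ∀ v ∈ p, ∀ v' ∈ q, r (c v) (c v')} =
    Nat.card (relColorings F.Node r n) := by
  have hex : ∀ v, ∃ p : F.Node, v ∈ p.1 := by
    intro v
    obtain ⟨p, hp, hv⟩ : v ∈ F.support := by rw [h]; trivial
    exact ⟨⟨p, hp⟩, hv⟩
  -- Each vertex gets the node containing it and each node a sample vertex; pulling back along these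
  -- choices gives the two inverse maps.
  choose node hnode using hex
  choose pt hpt using fun p : F.Node => F.nonempty p.1 p.2
  have hnp : ∀ p v, v ∈ p.1 → node v = p := fun p v hv =>
    Subtype.ext (node_eq (node v).2 p.2 (hnode v) hv)
  rw [← Nat.card_coe_set_eq]
  refine Nat.card_congr
    { toFun := fun c => ⟨fun p => c.1 (pt p), fun p q hpq => ?_, fun p => (c.1 (pt p)).2⟩
      invFun := fun d => ⟨fun v => ⟨d.1 (node v), d.2.2 _⟩, fun p hp v hv v' hv' => ?_,
        fun p q hpq hne v hv v' hv' => ?_⟩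
      left_inv := fun c => ?_
      right_inv := fun d => ?_ }
  · exact c.2.2 p.1 q.1 hpq.le (fun e => hpq.ne (Subtype.ext e)) _ (hpt p) _ (hpt q)
  · rw [Fin.mk.injEq, hnp ⟨p, hp⟩ v hv, hnp ⟨p, hp⟩ v' hv']
  · have hm := F.mem_of_le hpq
    have hle : node v ≤ node v' := by
      rw [hnp ⟨p, hm.1⟩ v hv, hnp ⟨q, hm.2⟩ v' hv']
      exact hpq
    refine d.2.1 _ _ (lt_of_le_of_ne hle fun e => hne ?_)
    rw [hnp ⟨p, hm.1⟩ v hv, hnp ⟨q, hm.2⟩ v' hv'] at e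
    exact congrArg Subtype.val e
  · exact Subtype.ext (funext fun v => c.2.1 _ (node v).2 _ (hpt (node v)) _ (hnode v))
  · exact Subtype.ext (funext fun p => congrArg d.1 (hnp p _ (hpt p)))

theorem exists_polynomial_strictColorings [Finite V] (K : Type*) [Field K] [CharZero K]
    (h : F.support = Set.univ) :
    ∃ P : Polynomial K, (∀ n : ℕ, P.eval (n : K) = ((F.strictColorings n).ncard : K)) ∧
      ∀ n : ℕ, P.eval (-(n : K)) = (-1) ^ Nat.card F.Node * ((F.colorings n).ncard : K) := by
  obtain ⟨P, hP, hP'⟩ := exists_orderPolynomial _ F.Node rfl fun _ _ _ h h' => F.le_chain h h'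
  refine ⟨P.map (algebraMap ℚ K), fun n => ?_, fun n => ?_⟩
  · have h1 : (F.strictColorings n).ncard = _ := ncard_forestColorings h (· < ·) n
    rw [h1, ← map_natCast (algebraMap ℚ K) n, Polynomial.eval_map_apply, hP, map_natCast]
  · have h1 : (F.colorings n).ncard = _ := ncard_forestColorings h (· ≤ ·) n
    rw [h1, ← map_natCast (algebraMap ℚ K) n, ← map_neg, Polynomial.eval_map_apply, hP',
      map_mul, map_natCast, map_pow, map_neg, map_one]

end Count

/-! ### Regrouping colourings by forests. -/

section Main

variable {K : Type w} [Field K] (ζ : Character (graphHopf.{u} K)) {V : Type u} [Finite V]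
  (g : SimpleGraph V)

/-- Each colouring contributes to exactly one forest, `colorForest g c`, with weight `ζ(g_F)`;
exchanging the two sums counts the strictly compatible colourings of each forest. -/
theorem graphChi_eq_sum_forests (n : ℕ) :
    graphChi ζ g n = ∑ᶠ F ∈ partitioningForests g,
      ζ.onGraph (ripSew g F) * ((F.strictColorings n).ncard : K) := by
  classical
  have := Fintype.ofFinite (LabelledForest V)
  have := Fintype.ofFinite V
  have hc : ∀ c : V → Fin n, ζ.onGraph (colorGraph g c) =
      ∑ F ∈ (partitioningForests g).toFinset,
        if F.StrictlyCompatible c then ζ.onGraph (ripSew g F) else 0 := by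
    intro c
    rw [Finset.sum_eq_single_of_mem (colorForest g c)]
    · have hs : (colorForest g c).StrictlyCompatible c := isStrict_colorForest g c
      rw [if_pos hs, (nested_colorForest g c).ripSew_eq (isStrict_colorForest g c)]
    · rw [Set.mem_toFinset, mem_partitioningForests_iff]
      exact nested_colorForest g c
    · intro F hF hne
      rw [Set.mem_toFinset, mem_partitioningForests_iff] at hF
      exact if_neg fun h => hne (hF.eq_colorForest h)
  rw [graphChi_eq_sum, finsum_eq_sum_of_fintype, Finset.sum_congr rfl fun c _ => hc c,
    Finset.sum_comm, finsum_mem_eq_toFinset_sum]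
  refine Finset.sum_congr rfl fun F _ => ?_
  rw [← Finset.sum_filter, Finset.sum_const, nsmul_eq_mul, mul_comm, strictColorings,
    Set.ncard_eq_toFinset_card']
  congr 3
  ext c
  simp

/-- A sum of `0`-`1` values of a character weighted by numbers of colourings counts pairs. -/
theorem sum_forests_eq_ncard (hζ : ζ.IsCharacteristic) {C : Type*} [Finite C]
    (R : LabelledForest V → C → Prop) :
    ∑ᶠ F ∈ partitioningForests g, ζ.onGraph (ripSew g F) * ((Set.ncard {c | R F c} : ℕ) : K) =
      (Set.ncard {x : LabelledForest V × C |
        x.1 ∈ zetaPartitioningForests ζ g ∧ R x.1 x.2} : K) := by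
  classical
  have := Fintype.ofFinite (LabelledForest V)
  have := Fintype.ofFinite C
  have h : {x : LabelledForest V × C | x.1 ∈ zetaPartitioningForests ζ g ∧ R x.1 x.2}.ncard =
      ∑ F ∈ (zetaPartitioningForests ζ g).toFinset, {c | R F c}.ncard := by
    rw [← Finset.sum_set_coe, ← Nat.card_coe_set_eq, ← Finset.sum_congr rfl fun F _ =>
      Nat.card_coe_set_eq {c | R F.1 c}, ← Nat.card_sigma]
    exact Nat.card_congr
      { toFun := fun x => ⟨⟨x.1.1, x.2.1⟩, x.1.2, x.2.2⟩
        invFun := fun y => ⟨(y.1.1, y.2.1), y.1.2, y.2.2⟩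
        left_inv := fun _ => rfl
        right_inv := fun _ => rfl }
  rw [h, finsum_mem_eq_toFinset_sum, Nat.cast_sum]
  symm
  -- Forests with `ζ(g_F) = 0` contribute nothing, and for the others the value is `1`.
  refine Finset.sum_subset_zero_on_sdiff ?_ ?_ ?_
  · exact Set.toFinset_mono fun F hF => hF.1
  · intro F hF
    rw [Finset.mem_sdiff, Set.mem_toFinset, Set.mem_toFinset] at hF
    have : ζ.onGraph (ripSew g F) = 0 := by
      by_contra h0
      exact hF.2 ⟨hF.1, h0⟩
    rw [this, zero_mul]
  · intro F hF
    rw [Set.mem_toFinset] at hF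
    rw [(hζ V _).resolve_left hF.2, one_mul]

theorem Character.IsOdd.sign_ripSew (hζ : ζ.IsOdd) (F : LabelledForest V) (m : K) :
    (-1 : K) ^ Nat.card V * ((-1) ^ cc (ripSew g F) * ζ.onGraph (ripSew g F) * m) =
      ζ.onGraph (ripSew g F) * m := by
  by_cases h0 : ζ.onGraph (ripSew g F) = 0
  · simp [h0]
  · rw [ζ.neg_one_pow_card hζ _ h0, ← mul_assoc, ← mul_assoc, ← mul_pow]
    simp

end Main

end RipSew

end

theorem mainTheorem9 {K : Type w} [Field K] [CharZero K]
    (ζ : RipSew.Character (RipSew.graphHopf.{u} K)) (V : Type u) [Finite V] (g : SimpleGraph V) :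
    (∃ P : Polynomial K,
      (∀ n : ℕ, P.eval (n : K) = RipSew.graphChi ζ g n) ∧
      (∀ n : ℕ, RipSew.graphChi ζ g n =
        ∑ᶠ F ∈ RipSew.partitioningForests g,
          ζ.onGraph (RipSew.ripSew g F) * ((F.strictColorings n).ncard : K)) ∧
      (∀ n : ℕ, P.eval (-(n : K)) =
        ∑ᶠ F ∈ RipSew.partitioningForests g,
          (-1 : K) ^ RipSew.cc (RipSew.ripSew g F) * ζ.onGraph (RipSew.ripSew g F) *
            ((F.colorings n).ncard : K)) ∧
      (ζ.IsCharacteristic →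
        (∀ n : ℕ, RipSew.graphChi ζ g n =
          (Set.ncard {x : RipSew.LabelledForest V × (V → Fin n) |
            x.1 ∈ RipSew.zetaPartitioningForests ζ g ∧ x.1.StrictlyCompatible x.2} : K)) ∧
        (ζ.IsOdd →
          (∀ n : ℕ, (-1 : K) ^ Nat.card V * P.eval (-(n : K)) =
            (Set.ncard {x : RipSew.LabelledForest V × (V → Fin n) |
              x.1 ∈ RipSew.zetaPartitioningForests ζ g ∧ x.1.Compatible x.2} : K)) ∧
          (-1 : K) ^ Nat.card V * P.eval (-1) =
            ((RipSew.zetaPartitioningForests ζ g).ncard : K)))) ∧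
    RipSew.partitioningForests g = RipSew.buildingForests (RipSew.tubes g) := by 
  classical
  have := Fintype.ofFinite (RipSew.LabelledForest V)
  -- Membership in `PF(g)` is kept inside the statement so that the choice of `P` is defined on all
  -- forests; outside `PF(g)` it may be `0`.
  have hpoly : ∀ F : RipSew.LabelledForest V, ∃ P : Polynomial K,
      F ∈ RipSew.partitioningForests g →
        (∀ n : ℕ, P.eval (n : K) = ((F.strictColorings n).ncard : K)) ∧
        ∀ n : ℕ, P.eval (-(n : K)) =
          (-1) ^ RipSew.cc (RipSew.ripSew g F) * ((F.colorings n).ncard : K) := by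
    intro F
    by_cases hF : F ∈ RipSew.partitioningForests g
    · have h := RipSew.mem_partitioningForests_iff.1 hF
      obtain ⟨P, hP⟩ := RipSew.exists_polynomial_strictColorings K h.support
      exact ⟨P, fun _ => by rwa [h.cc_ripSew]⟩
    · exact ⟨0, fun h => absurd h hF⟩
  choose P hP using hpoly
  have hneg : ∀ n : ℕ, (∑ F ∈ (RipSew.partitioningForests g).toFinset,
      Polynomial.C (ζ.onGraph (RipSew.ripSew g F)) * P F).eval (-(n : K)) =
        ∑ᶠ F ∈ RipSew.partitioningForests g,
          (-1 : K) ^ RipSew.cc (RipSew.ripSew g F) * ζ.onGraph (RipSew.ripSew g F) *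
            ((F.colorings n).ncard : K) := by
    intro n
    rw [finsum_mem_eq_toFinset_sum, Polynomial.eval_finsetSum]
    refine Finset.sum_congr rfl fun F hF => ?_
    rw [Polynomial.eval_mul, Polynomial.eval_C, (hP F (Set.mem_toFinset.1 hF)).2]
    ring
  have hchar : ζ.IsCharacteristic → ζ.IsOdd → ∀ n : ℕ,
      (-1 : K) ^ Nat.card V * (∑ F ∈ (RipSew.partitioningForests g).toFinset,
        Polynomial.C (ζ.onGraph (RipSew.ripSew g F)) * P F).eval (-(n : K)) =
          (Set.ncard {x : RipSew.LabelledForest V × (V → Fin n) |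
            x.1 ∈ RipSew.zetaPartitioningForests ζ g ∧ x.1.Compatible x.2} : K) := by
    intro hζ hodd n
    rw [hneg, ← RipSew.sum_forests_eq_ncard ζ g hζ fun F c => F.Compatible c,
      finsum_mem_eq_toFinset_sum, finsum_mem_eq_toFinset_sum, Finset.mul_sum]
    exact Finset.sum_congr rfl fun F _ => hodd.sign_ripSew ζ g F _
  refine ⟨⟨_, fun n => ?_, RipSew.graphChi_eq_sum_forests ζ g, hneg, fun hζ => ⟨fun n => ?_,
    fun hodd => ⟨hchar hζ hodd, ?_⟩⟩⟩, RipSew.partitioningForests_eq_buildingForests g⟩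
  · rw [RipSew.graphChi_eq_sum_forests, finsum_mem_eq_toFinset_sum, Polynomial.eval_finsetSum]
    refine Finset.sum_congr rfl fun F hF => ?_
    rw [Polynomial.eval_mul, Polynomial.eval_C, (hP F (Set.mem_toFinset.1 hF)).1]
  · rw [RipSew.graphChi_eq_sum_forests]
    exact RipSew.sum_forests_eq_ncard ζ g hζ fun F c => F.StrictlyCompatible c
  · have h1 := hchar hζ hodd 1
    rw [Nat.cast_one] at h1
    rw [h1]
    congr 1
    -- With one colour there is a single colouring, and it is weakly compatible with every forest,
    -- so pairs are the same as forests.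
    refine Set.ncard_congr (fun x _ => x.1) (fun x hx => hx.1) (fun x y _ _ h => ?_) fun F hF => ?_
    · exact Prod.ext h (Subsingleton.elim _ _)
    · exact ⟨(F, 0), ⟨hF, fun _ _ _ _ _ _ => rfl, fun _ _ _ _ _ _ _ _ => le_rfl⟩, rfl⟩
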